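/- Let $G$ be a locally compact (Hausdorff) abelian group with dual group $\widehat G$, and let $dx\,d\chi$ be a (Radon) Haar measure on $G\times\widehat G$. Let $A$ be a (not necessarily unital) complex commutative Banach algebra with a bounded approximate identity, let $A^*$ be its Banach dual, let $1<p<\infty$ and $\frac1p+\frac1{p'}=1$. $L^r(G\times\widehat G;E)$ denotes the space of Bochner $r$-integrable functions with values in the Banach space $E$. For functions on $G\times\widehat G$ put $$(T^t_{(x',\chi')}f)(x,\chi)=f(xx'^{-1},\chi\overline{\chi'})\,\chi'(xx'^{-1}),\qquad (L^t_{(x',\chi')}f)(x,\chi)=f(xx'^{-1},\chi\overline{\chi'})\,(\chi\overline{\chi'})(x'),$$ $(\Lambda_a f)(x,\chi)=a\,f(x,\chi)$ for $a\in A$, and $$(f\times g)(x,\chi)=\int_{G\times\widehat G}(T^t_{(x',\chi')}f)(x,\chi)\,g(x',\chi')\,dx'\,d\chi'.$$ For $a\in A$ and $\varphi\in A^*$ let $a\odot\varphi\in A^*$ be $(a\odot\varphi)(b)=\varphi(ba)$. For $f\in L^1(G\times\widehat G;A)$ and $h\in L^{p'}(G\times\widehat G;A^*)$ let $$(f\oplus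 h)(x',\chi')=\int_{G\times\widehat G}(L^t_{(x',\chi')}f)(x,\chi)\odot h(x,\chi)\,dx\,d\chi ,$$ an element of $L^{p'}(G\times\widehat G;A^*)$, and for $\nu\in\big(L^{p'}(G\times\widehat G;A^*)\big)^*$ define $\nu\divideontimes f\in\big(L^{p'}(G\times\widehat G;A^*)\big)^*$ by $\langle\nu\divideontimes f,h\rangle=\nu(f\oplus h)$. An element $g\in L^p(G\times\widehat G;A)$ is regarded as an element of $\big(L^{p'}(G\times\widehat G;A^*)\big)^*$ through $\langle g,h\rangle=\int_{G\times\widehat G}\langle g(x,\chi),h(x,\chi)\rangle\,dx\,d\chi$. Let $T:L^1(G\times\widehat G;A)\to L^p(G\times\widehat G;A)$ be a continuous linear operator. Then the following are equivalent: 1. $T$ is a Weyl multiplier, that is, $TT^t_{(x,\chi)}=T^t_{(x,\chi)}T$ for all $(x,\chi)\in G\times\widehat G$, and $T(fa)=T(f)a$ for all $a\in A$ and $f\in L^1(G\times\widehat G;A)$. 2. $T(\Lambda_aT^t_{(x,\chi)})=(\Lambda_aT^t_{(x,\chi)})T$ for all $a\in A$ and $(x,\chi)\in G\times\widehat G$.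 3. $T(f\times g)=Tf\times g$ for all $f,g\in L^1(G\times\widehat G;A)$. 4. There exists $\nu\in\big(L^{p'}(G\times\widehat G;A^*)\big)^*$ such that $Tf=\nu\divideontimes f$ for all $f\in L^1(G\times\widehat G;A)$. -/

import Mathlib

open MeasureTheory ENNReal

noncomputable section

namespace WeylMultiplier

/-- The group `G × Ĝ`, with the product topology and the product group structure. (It is a type of
its own so that it carries its Borel σ-algebra, which for general `G` is larger than the product
of the Borel σ-algebras of the factors.) -/
def PhaseSpace (G : Type*) [CommGroup G] [TopologicalSpace G] : Type _ :=
  G × PontryaginDual G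

namespace PhaseSpace

variable {G : Type*} [CommGroup G] [TopologicalSpace G]

instance : CommGroup (PhaseSpace G) := inferInstanceAs (CommGroup (G × PontryaginDual G))

instance : TopologicalSpace (PhaseSpace G) :=
  inferInstanceAs (TopologicalSpace (G × PontryaginDual G))

instance [IsTopologicalGroup G] : IsTopologicalGroup (PhaseSpace G) :=
  inferInstanceAs (IsTopologicalGroup (G × PontryaginDual G))

instance [IsTopologicalGroup G] [LocallyCompactSpace G] : LocallyCompactSpace (PhaseSpace G) :=
  inferInstanceAs (LocallyCompactSpace (G × PontryaginDual G))

instance [T2Space G] : T2Space (PhaseSpace G) :=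
  inferInstanceAs (T2Space (G × PontryaginDual G))

instance : MeasurableSpace (PhaseSpace G) := borel _

instance : BorelSpace (PhaseSpace G) := ⟨rfl⟩

/-- The value `χ(y) ∈ ℂ` of the character `χ` of the point `w = (x, χ)` at `y ∈ G`. -/
def char (w : PhaseSpace G) (y : G) : ℂ := ((w.2 y : Circle) : ℂ)

theorem norm_char (w : PhaseSpace G) (y : G) : ‖w.char y‖ = 1 := Circle.norm_coe _

end PhaseSpace

section Pointwise

variable {G : Type*} [CommGroup G] [TopologicalSpace G] {E : Type*} [SMul ℂ E]

/-- The twisted translate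
`(T^t_{(x', χ')} f)(x, χ) = f (x x'⁻¹, χ χ'⁻¹) χ'(x x'⁻¹)`, with `z = (x', χ')`, `w = (x, χ)`. -/
def twistedTranslate (z : PhaseSpace G) (f : PhaseSpace G → E) (w : PhaseSpace G) : E :=
  z.char (w.1 / z.1) • f (w / z)

/-- The left twisted translate
`(L^t_{(x', χ')} f)(x, χ) = f (x x'⁻¹, χ χ'⁻¹) (χ χ'⁻¹)(x')`, with `z = (x', χ')`,
`w = (x, χ)`. -/
def leftTwistedTranslate (z : PhaseSpace G) (f : PhaseSpace G → E) (w : PhaseSpace G) : E :=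
  (w / z).char z.1 • f (w / z)

end Pointwise

section Lp

variable {G : Type*} [CommGroup G] [TopologicalSpace G] [IsTopologicalGroup G]
  {E : Type*} [NormedAddCommGroup E] [NormedSpace ℂ E]
  {μ : Measure (PhaseSpace G)} [μ.IsHaarMeasure] {p : ℝ≥0∞}

theorem memLp_twistedTranslate (z : PhaseSpace G) {f : PhaseSpace G → E} (hf : MemLp f p μ) :
    MemLp (twistedTranslate z f) p μ := by
  have hc : Continuous fun w : PhaseSpace G => z.char (w.1 / z.1) := by
    have h1 : Continuous fun w : PhaseSpace G => w.1 / z.1 :=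
      (continuous_fst (X := G) (Y := PontryaginDual G)).div_const z.1
    exact continuous_induced_dom.comp ((map_continuous z.2).comp h1)
  have h := hf.comp_measurePreserving (measurePreserving_div_right μ z)
  refine h.of_le (hc.aestronglyMeasurable.smul h.1) (Filter.Eventually.of_forall fun w => ?_)
  simp only [twistedTranslate, norm_smul, PhaseSpace.norm_char, one_mul, Function.comp]
  exact le_rfl

/-- The twisted translation operator `T^t_z` on `L^p(G × Ĝ; E)`. -/
def twistedTranslateLp (z : PhaseSpace G) (f : Lp E p μ) : Lp E p μ :=
  (memLp_twistedTranslate z (Lp.memLp f)).toLp _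

end Lp

section Algebra

variable (A : Type*) [NonUnitalNormedCommRing A]

/-- `A` has a bounded approximate identity: there is a proper filter on `A` (the filter of tails of
a net `(e_β)`) that is eventually bounded and along which `e a → a` and `a e → a` for all `a`. -/
def HasBoundedApproximateIdentity : Prop :=
  ∃ (l : Filter A) (C : ℝ), l.IsApproximateUnit ∧ ∀ᶠ e in l, ‖e‖ ≤ C

variable {A} [NormedSpace ℂ A] {G : Type*} [CommGroup G] [TopologicalSpace G]

section Dual

variable {μ : Measure (PhaseSpace G)} {p q : ℝ≥0∞}

/-- The functional on `L^q(G × Ĝ; A*)` that `g ∈ L^p(G × Ĝ; A)` defines: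
`h ↦ ∫ ⟨g(x, χ), h(x, χ)⟩ dx dχ`, for conjugate exponents `p` and `q`. -/
def toDual [Fact (1 ≤ p)] [Fact (1 ≤ q)] [HolderConjugate p q] (g : Lp A p μ) :
    StrongDual ℂ (Lp (StrongDual ℂ A) q μ) :=
  (NormedSpace.inclusionInDoubleDual ℂ A).lpPairing μ p q g

theorem toDual_apply [Fact (1 ≤ p)] [Fact (1 ≤ q)] [HolderConjugate p q] (g : Lp A p μ)
    (h : Lp (StrongDual ℂ A) q μ) : toDual g h = ∫ w, h w (g w) ∂μ :=
  ContinuousLinearMap.lpPairing_eq_integral _ _ _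

end Dual

variable [IsScalarTower ℂ A A] [SMulCommClass ℂ A A]

/-- The functional `a ⊙ φ ∈ A*`, given by `(a ⊙ φ)(b) = φ (b a)`. -/
def arens (a : A) (φ : StrongDual ℂ A) : StrongDual ℂ A :=
  φ.comp ((ContinuousLinearMap.mul ℂ A).flip a)

theorem arens_apply (a : A) (φ : StrongDual ℂ A) (b : A) : arens a φ b = φ (b * a) := rfl

variable (μ : Measure (PhaseSpace G))

/-- The twisted convolution
`(f × g)(x, χ) = ∫ (T^t_{(x', χ')} f)(x, χ) g(x', χ') dx' dχ'` of `A`-valued functions. -/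
def twistedConv (f g : PhaseSpace G → A) (w : PhaseSpace G) : A :=
  ∫ z, twistedTranslate z f w * g z ∂μ

/-- `(f ⊕ h)(x', χ') = ∫ (L^t_{(x', χ')} f)(x, χ) ⊙ h(x, χ) dx dχ`, for an `A`-valued function `f`
and an `A*`-valued function `h`. -/
def oplus (f : PhaseSpace G → A) (h : PhaseSpace G → StrongDual ℂ A) (z : PhaseSpace G) :
    StrongDual ℂ A :=
  ∫ w, arens (leftTwistedTranslate z f w) (h w) ∂μ

variable {μ} {p q : ℝ≥0∞}

/-- The operator `Λ_a f = a f` on `L^p(G × Ĝ; A)`. -/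
def lmulLp [Fact (1 ≤ p)] (a : A) : Lp A p μ →L[ℂ] Lp A p μ :=
  (ContinuousLinearMap.mul ℂ A a).compLpL p μ

/-- The operator `f ↦ f a` on `L^p(G × Ĝ; A)`. -/
def rmulLp [Fact (1 ≤ p)] (a : A) : Lp A p μ →L[ℂ] Lp A p μ :=
  ((ContinuousLinearMap.mul ℂ A).flip a).compLpL p μ

/-- `T : L^1(G × Ĝ; A) → L^p(G × Ĝ; A)` is a Weyl multiplier: it commutes with all twisted
translations, and `T (f a) = (T f) a`. -/
def IsWeylMultiplier [IsTopologicalGroup G] [μ.IsHaarMeasure] [Fact (1 ≤ p)]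
    (T : Lp A 1 μ →L[ℂ] Lp A p μ) : Prop :=
  (∀ (z : PhaseSpace G) (f : Lp A 1 μ), T (twistedTranslateLp z f) = twistedTranslateLp z (T f)) ∧
    ∀ (a : A) (f : Lp A 1 μ), T (rmulLp a f) = rmulLp a (T f)

/-- `Φ = ν ⋇ f`: for every `h ∈ L^q(G × Ĝ; A*)` the function `f ⊕ h` is (almost everywhere equal to)
an element `k` of `L^q(G × Ĝ; A*)`, and `⟨Φ, h⟩ = ν (f ⊕ h)`. -/
def IsDivideontimes [Fact (1 ≤ q)] (ν : StrongDual ℂ (Lp (StrongDual ℂ A) q μ)) (f : Lp A 1 μ)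
    (Φ : StrongDual ℂ (Lp (StrongDual ℂ A) q μ)) : Prop :=
  ∀ h : Lp (StrongDual ℂ A) q μ,
    ∃ k : Lp (StrongDual ℂ A) q μ, k =ᵐ[μ] oplus μ f h ∧ Φ h = ν k

end Algebra

end WeylMultiplier

end

open MeasureTheory ENNReal

noncomputable section

namespace WeylMultiplier

open Filter Topology Function
open scoped Pointwise

/-! ### Density of compactly supported continuous functions in `L^p`, and strong measurability -/

section Density

variable {X : Type*} [TopologicalSpace X] [LocallyCompactSpace X] [T2Space X]
  [MeasurableSpace X] [BorelSpace X] {μ : Measure X} [μ.Regular]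
  {E : Type*} [NormedAddCommGroup E] [NormedSpace ℝ E] {p : ℝ≥0∞}

/-! The twisted convolution `f × g` is the `L^p`-valued Bochner integral of `z ↦ (T^t_z f) g(z)`, so
it is a superposition of twisted translations followed by multiplication by elements of `A`. An
operator that commutes with those passes under the integral (`map_kernelConvLp`, 1 → 3). Conversely,
if `g` is `a` times the normalised indicator of a small compact neighbourhood of `z`, then `f × g`
is close to `a T^t_z f`, because twisted translation is strongly continuous
(`map_applyLp_kernelTranslateLp`, 3 → 2). Letting `a` run through the approximate identity of `A`,
or taking `z = 1`, separates the two commutation relations (2 → 1); right and left multiplication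
agree since `A` is commutative.

For 3 → 4, averages near `1` with values in the bounded approximate identity give a bounded family
`e_i` in `L^1` with `e_i × f → f` (`tendsto_kernelConvLp_averageLp`). The functionals defined by `T
e_i` are bounded, so they have a weak-* limit `ν` along an ultrafilter. By the duality `⟨F × f, h⟩ =
⟨F, f ⊕ h⟩` (`toDual_kernelConvLp`), `⟨Tf, h⟩ = lim ⟨T e_i × f, h⟩ = lim ⟨T e_i, f ⊕ h⟩ = ν (f ⊕
h)`. For 4 → 2, the operator `Λ_a T^t_z` has the same transpose `dualTranslate` with respect to `⊕`
and to the pairing, and `L^p(A)` embeds in the dual of `L^q(A*)`.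

The analytic difficulty is that the Haar measure need not be σ-finite, nor the range of a continuous
function separable. Measurability and Fubini are therefore obtained for continuous functions with
compact support and extended by absolutely convergent series. The identification of the Bochner
integral with the pointwise formula (`coeFn_kernelConvLp`) is the main such step. Only continuity
and modulus one of the twisting factor matter there, so one general kernel serves `×`, its flip, `⊕`
and the untwisted scalar majorant. -/

variable (μ E p) in
/-- The classes in `L^p` of the continuous functions with compact support. -/
def compactlySupportedLp : AddSubgroup (Lp E p μ) where
  carrier := {f | ∃ g : X → E, Continuous g ∧ HasCompactSupport g ∧ f =ᵐ[μ] g}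
  add_mem' := by
    rintro a b ⟨f, hf, hf', haf⟩ ⟨g, hg, hg', hbg⟩
    exact ⟨f + g, hf.add hg, hf'.add hg', (Lp.coeFn_add a b).trans (haf.add hbg)⟩
  zero_mem' := ⟨0, continuous_zero, HasCompactSupport.zero, Lp.coeFn_zero _ _ _⟩
  neg_mem' := by
    rintro a ⟨f, hf, hf', haf⟩
    exact ⟨-f, hf.neg, hf'.neg, (Lp.coeFn_neg a).trans haf.neg⟩

omit [LocallyCompactSpace X] [T2Space X] [NormedSpace ℝ E] in
theorem toLp_mem_compactlySupportedLp {f : X → E} (hf : Continuous f) (hf' : HasCompactSupport f) :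
    (hf.memLp_of_hasCompactSupport hf').toLp f ∈ compactlySupportedLp μ E p :=
  ⟨f, hf, hf', MemLp.coeFn_toLp _⟩

/-- The indicator of a set of finite measure is a limit in `L^p` of continuous functions with
compact support. -/
theorem exists_hasCompactSupport_eLpNorm_sub_indicator_le (hp : p ≠ ∞) {t : Set X}
    (ht : MeasurableSet t) (hμt : μ t < ∞) (v : E) {ε : ℝ≥0∞} (hε : ε ≠ 0) :
    ∃ g : X → E, eLpNorm (g - t.indicator fun _ => v) p μ ≤ ε ∧
      Continuous g ∧ HasCompactSupport g := by
  obtain ⟨δ, δpos, hδ⟩ := exists_Lp_half E μ p hε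
  obtain ⟨η, ηpos, hη⟩ := exists_eLpNorm_indicator_le (μ := μ) hp v δpos.ne'
  have hη' : (η : ℝ≥0∞) ≠ 0 := by simpa using ηpos.ne'
  obtain ⟨s, st, hs, hsc, μs⟩ := ht.exists_isCompact_isClosed_sdiff_lt hμt.ne hη'
  have hμs : μ s < ∞ := (measure_mono st).trans_lt hμt
  obtain ⟨V, sV, hV, -, hμV⟩ := hs.measurableSet.exists_isOpen_sdiff_lt hμs.ne hη'
  obtain ⟨φ, hφ1, hφ0, hφc, hφ⟩ := exists_continuous_one_zero_of_isCompact hs hV.isClosed_compl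
    (Set.disjoint_compl_right_iff_subset.2 sV)
  refine ⟨fun x => φ x • v, ?_, by fun_prop, hφc.smul_right⟩
  -- The bump `φ` differs from the indicator of `s` only on `V \ s`, a set of small measure, and
  -- there by at most `1`.
  have h1 : eLpNorm ((fun x => φ x • v) - s.indicator fun _ => v) p μ ≤ δ := by
    refine (eLpNorm_mono (g := (V \ s).indicator fun _ => v) fun x => ?_).trans (hη _ hμV.le)
    by_cases hxs : x ∈ s
    · simp [hxs, hφ1 hxs]
    · by_cases hxV : x ∈ V
      · simp only [Pi.sub_apply, hxs, not_false_eq_true, Set.indicator_of_notMem, sub_zero,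
          Set.mem_sdiff, hxV, and_self, Set.indicator_of_mem, norm_smul]
        refine mul_le_of_le_one_left (norm_nonneg _) ?_
        rw [Real.norm_of_nonneg (hφ x).1]
        exact (hφ x).2
      · simp [hxs, hxV, hφ0 hxV]
  have h2 : eLpNorm ((s.indicator fun _ => v) - t.indicator fun _ => v) p μ ≤ δ := by
    rw [← eLpNorm_neg, neg_sub, ← Set.indicator_sdiff st]
    exact hη _ μs.le
  have hm : AEStronglyMeasurable (fun x => φ x • v) μ :=
    (Continuous.memLp_of_hasCompactSupport (p := p) (by fun_prop) hφc.smul_right).1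
  have h3 := (hδ _ _ (hm.sub (aestronglyMeasurable_const.indicator hsc.measurableSet))
    ((aestronglyMeasurable_const.indicator hsc.measurableSet).sub
      (aestronglyMeasurable_const.indicator ht)) h1 h2).le
  rwa [sub_add_sub_cancel] at h3

theorem dense_compactlySupportedLp [Fact (1 ≤ p)] (hp : p ≠ ∞) :
    Dense (compactlySupportedLp μ E p : Set (Lp E p μ)) := by
  refine fun f => ?_
  rw [EMetric.mem_closure_iff]
  intro ε hε
  obtain ⟨δ, δpos, hδ⟩ := exists_between hε
  have key : ∃ g : X → E, eLpNorm (⇑f - g) p μ ≤ δ ∧ Continuous g ∧ HasCompactSupport g := by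
    refine (Lp.memLp f).induction_dense hp (fun g => Continuous g ∧ HasCompactSupport g)
      ?_ ?_ ?_ δpos.ne'
    · exact fun c s hs hμs ε hε =>
        exists_hasCompactSupport_eLpNorm_sub_indicator_le hp hs hμs c hε
    · exact fun f g hf hg => ⟨hf.1.add hg.1, hf.2.add hg.2⟩
    · exact fun f hf => (hf.1.memLp_of_hasCompactSupport (p := p) hf.2).1
  obtain ⟨g, hg, hg', hgc⟩ := key
  refine ⟨_, toLp_mem_compactlySupportedLp hg' hgc, ?_⟩
  have h : edist f ((hg'.memLp_of_hasCompactSupport hgc).toLp g) = eLpNorm (⇑f - g) p μ := by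
    rw [Lp.edist_def]
    exact eLpNorm_congr_ae ((ae_eq_refl _).sub (MemLp.coeFn_toLp _))
  rw [h]
  exact hg.trans_lt hδ

/-- Every element of `L^p`, `p < ∞`, is the sum of an absolutely convergent series of continuous
functions with compact support. -/
theorem exists_hasSum_hasCompactSupport [Fact (1 ≤ p)] (hp : p ≠ ∞) (f : Lp E p μ) :
    ∃ v : ℕ → Lp E p μ, ∃ g : ℕ → X → E, (∀ n, Continuous (g n)) ∧
      (∀ n, HasCompactSupport (g n)) ∧ (∀ n, v n =ᵐ[μ] g n) ∧ (Summable fun n => ‖v n‖) ∧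
      HasSum v f := by
  obtain ⟨v, hv, hvs, -, hvb⟩ := controlled_sum_of_mem_closure (dense_compactlySupportedLp hp f)
    (b := fun n => (1 / 2 : ℝ) ^ n) fun n => by positivity
  choose g hg hg' hvg using hvs
  have hs : Summable fun n => ‖v n‖ := by
    -- The geometric bound `hvb` holds for positive indices only, so the first term is split off.
    rw [← summable_nat_add_iff 1]
    exact Summable.of_nonneg_of_le (fun n => norm_nonneg _) (fun n => (hvb (n + 1) n.succ_pos).le)
      ((summable_nat_add_iff 1).2 summable_geometric_two)
  refine ⟨v, g, hg, hg', hvg, hs, ?_⟩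
  exact (hasSum_iff_tendsto_nat_of_summable_norm hs).2 ((tendsto_add_atTop_iff_nat 1).1 hv)

/-- If `g` is integrable with respect to a regular measure, `ψ` is continuous and `D` is a
continuous bilinear map, then `z ↦ D (ψ z) (g z)` is strongly measurable, even though `ψ` need not
be. -/
theorem aestronglyMeasurable_bilin_of_continuous {F H : Type*} [NormedAddCommGroup F]
    [NormedSpace ℝ F] [NormedAddCommGroup H] {D : F → E → H} (hD : Continuous (uncurry D))
    (hD0 : ∀ x, D x 0 = 0) {ψ : X → F} (hψ : Continuous ψ) [Fact (1 ≤ p)] (hp : p ≠ ∞)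
    [CompleteSpace E] (g : Lp E p μ) :
    AEStronglyMeasurable (fun z => D (ψ z) (g z)) μ := by
  obtain ⟨v, γ, hγ, hγ', hvγ, hs, hvg⟩ := exists_hasSum_hasCompactSupport hp g
  have hs' : ∑' n, ‖v n‖ₑ ≠ ∞ := tsum_enorm_ne_top_iff_summable_norm.2 hs
  have hlim : ∀ᵐ z ∂μ, HasSum (fun n => γ n z) (g z) := by
    filter_upwards [Lp.hasSum_coeFn_tsum hs', ae_all_iff.2 hvγ] with z hz hz'
    simpa only [hz', hvg.tsum_eq] using hz
  refine aestronglyMeasurable_of_tendsto_ae atTop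
    (f := fun (n : ℕ) z => D (ψ z) (∑ i ∈ Finset.range n, γ i z)) (fun n => ?_) ?_
  -- Since `D x 0 = 0`, compact support of the partial sum cuts off `ψ`; a continuous function with
  -- compact support has separable range.
  · refine (Continuous.stronglyMeasurable_of_hasCompactSupport ?_ ?_).aestronglyMeasurable
    · have hc : Continuous fun z => ∑ i ∈ Finset.range n, γ i z :=
        continuous_finsetSum _ fun i _ => hγ i
      exact hD.comp (hψ.prodMk hc)
    · have hc : HasCompactSupport fun z => ∑ i ∈ Finset.range n, γ i z := by
        induction n with
        | zero =>
          simp only [Finset.range_zero, Finset.sum_empty]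
          exact HasCompactSupport.zero
        | succ n ih =>
          simp only [Finset.sum_range_succ]
          exact ih.add (hγ' n)
      refine hc.mono fun z hz => ?_
      contrapose! hz
      simp only [notMem_support] at hz ⊢
      rw [hz, hD0]
  · filter_upwards [hlim] with z hz
    exact (hD.comp (Continuous.prodMk_right (ψ z))).tendsto _ |>.comp hz.tendsto_sum_nat

end Density

/-! ### Twisted translations and twisted convolution for a unimodular kernel -/

section

/-- A continuous function `X × X → ℂ` of modulus one. -/
structure UnimodularKernel (X : Type*) [TopologicalSpace X] where
  /-- The underlying function. -/
  toFun : X → X → ℂ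
  continuous_uncurry : Continuous (uncurry toFun)
  norm_apply : ∀ u z, ‖toFun u z‖ = 1

namespace UnimodularKernel

variable {X : Type*} [TopologicalSpace X]

instance : CoeFun (UnimodularKernel X) fun _ => X → X → ℂ := ⟨toFun⟩

variable (X) in
/-- The kernel that is constant equal to one. -/
def one : UnimodularKernel X := ⟨fun _ _ => 1, continuous_const, fun _ _ => norm_one⟩

/-- The kernel with its two variables exchanged. -/
def swap (c : UnimodularKernel X) : UnimodularKernel X :=
  ⟨fun u z => c z u, c.continuous_uncurry.comp continuous_swap, fun u z => c.norm_apply z u⟩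

theorem continuous_comp (c : UnimodularKernel X) {Y : Type*} [TopologicalSpace Y] {f g : Y → X}
    (hf : Continuous f) (hg : Continuous g) : Continuous fun y => c (f y) (g y) :=
  c.continuous_uncurry.comp (hf.prodMk hg)

end UnimodularKernel

variable {X : Type*} [CommGroup X] [TopologicalSpace X]
  {E F H : Type*} [NormedAddCommGroup E] [NormedSpace ℂ E]
  [NormedAddCommGroup F] [NormedSpace ℂ F] [NormedAddCommGroup H] [NormedSpace ℂ H]

section Translate

/-- The translate of `f` by `z`, twisted by the kernel `c`. -/
def kernelTranslate (c : UnimodularKernel X) (z : X) (f : X → E) (w : X) : E :=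
  c (w / z) z • f (w / z)

variable [IsTopologicalGroup X] [MeasurableSpace X] [BorelSpace X]
  {μ : Measure X} [μ.IsHaarMeasure] {p : ℝ≥0∞}

theorem memLp_kernelTranslate (c : UnimodularKernel X) (z : X) {f : X → E} (hf : MemLp f p μ) :
    MemLp (kernelTranslate c z f) p μ := by
  have hc : Continuous fun w : X => c (w / z) z := c.continuous_comp (by fun_prop) (by fun_prop)
  have h := hf.comp_measurePreserving (measurePreserving_div_right μ z)
  refine h.of_le (hc.aestronglyMeasurable.smul h.1) (Eventually.of_forall fun w => ?_)
  simp only [kernelTranslate, norm_smul, c.norm_apply, one_mul, Function.comp]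
  exact le_rfl

theorem kernelTranslate_congr_ae (c : UnimodularKernel X) (z : X) {f g : X → E} (h : f =ᵐ[μ] g) :
    kernelTranslate c z f =ᵐ[μ] kernelTranslate c z g := by
  filter_upwards [(measurePreserving_div_right μ z).quasiMeasurePreserving.ae_eq_comp h] with w hw
  simp only [Function.comp] at hw
  simp only [kernelTranslate, hw]

theorem eLpNorm_kernelTranslate (c : UnimodularKernel X) (z : X) {f : X → E}
    (hf : AEStronglyMeasurable f μ) :
    eLpNorm (kernelTranslate c z f) p μ = eLpNorm f p μ := by
  rw [← eLpNorm_comp_measurePreserving hf (measurePreserving_div_right μ z)]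
  refine eLpNorm_congr_norm_ae (Eventually.of_forall fun w => ?_)
  simp [kernelTranslate, norm_smul, c.norm_apply]

/-- Twisted translation by `z` as an isometry of `L^p`. -/
def kernelTranslateLp [Fact (1 ≤ p)] (c : UnimodularKernel X) (z : X) :
    Lp E p μ →ₗᵢ[ℂ] Lp E p μ where
  toFun f := (memLp_kernelTranslate c z (Lp.memLp f)).toLp _
  map_add' f g := by
    rw [← MemLp.toLp_add]
    refine MemLp.toLp_congr _ _ ((kernelTranslate_congr_ae c z (Lp.coeFn_add f g)).trans ?_)
    exact Eventually.of_forall fun w => by simp [kernelTranslate]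
  map_smul' a f := by
    rw [RingHom.id_apply, ← MemLp.toLp_const_smul]
    refine MemLp.toLp_congr _ _ ((kernelTranslate_congr_ae c z (Lp.coeFn_smul a f)).trans ?_)
    exact Eventually.of_forall fun w => by simpa [kernelTranslate] using smul_comm _ _ _
  norm_map' f := by
    change ‖(memLp_kernelTranslate c z (Lp.memLp f)).toLp _‖ = _
    rw [Lp.norm_toLp, eLpNorm_kernelTranslate c z (Lp.aestronglyMeasurable f), Lp.norm_def]

theorem coeFn_kernelTranslateLp [Fact (1 ≤ p)] (c : UnimodularKernel X) (z : X) (f : Lp E p μ) :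
    kernelTranslateLp c z f =ᵐ[μ] kernelTranslate c z f :=
  MemLp.coeFn_toLp (memLp_kernelTranslate c z (Lp.memLp f))

/-- For `z` in a compact neighbourhood of `z₀` all translates live on one compact set `K`. The tube
lemma makes them uniformly close on `K`, which has finite measure. -/
theorem continuous_kernelTranslateLp_of_hasCompactSupport [LocallyCompactSpace X] [T2Space X]
    [Fact (1 ≤ p)] (c : UnimodularKernel X) {f : Lp E p μ} {g : X → E} (hg : Continuous g)
    (hg' : HasCompactSupport g) (hfg : f =ᵐ[μ] g) :
    Continuous fun z => kernelTranslateLp c z f := by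
  rw [continuous_iff_continuousAt]
  refine fun z₀ => Metric.tendsto_nhds.2 fun ε hε => ?_
  obtain ⟨V, hV, hVz⟩ := exists_compact_mem_nhds z₀
  set K : Set X := tsupport g * V
  have hK : IsCompact K := hg'.isCompact.mul hV
  have hout : ∀ z ∈ V, ∀ w ∉ K, kernelTranslate c z g w = 0 := by
    intro z hz w hw
    have : w / z ∉ tsupport g := fun h => hw ⟨_, h, z, hz, div_mul_cancel w z⟩
    simp [kernelTranslate, image_eq_zero_of_notMem_tsupport this]
  -- The `L^p` norm of the constant `δ` on `K` has to stay below `ε`; the `+ 1` makes the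
  -- denominator positive and the inequality strict.
  set δ : ℝ := ε / (μ.real K ^ (1 / p.toReal) + 1)
  have hpos : 0 < μ.real K ^ (1 / p.toReal) + 1 := by positivity
  have hδ : 0 < δ := div_pos hε hpos
  have hcont : Continuous fun zw : X × X => kernelTranslate c zw.1 g zw.2 :=
    (c.continuous_comp (by fun_prop) (by fun_prop)).smul (hg.comp (by fun_prop))
  have hopen : IsOpen {zw : X × X |
      ‖kernelTranslate c zw.1 g zw.2 - kernelTranslate c z₀ g zw.2‖ < δ} :=
    isOpen_lt (hcont.sub (hcont.comp (continuous_const.prodMk continuous_snd))).norm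
      continuous_const
  obtain ⟨U, W, hU, -, hzU, hKW, hUW⟩ := generalized_tube_lemma (isCompact_singleton (x := z₀)) hK
    hopen (by rintro ⟨z, w⟩ ⟨rfl, -⟩; simpa using hδ)
  filter_upwards [hVz, hU.mem_nhds (hzU rfl)] with z hzV hz
  rw [dist_eq_norm]
  have hle : ‖kernelTranslateLp c z f - kernelTranslateLp c z₀ f‖ ≤
      ‖indicatorConstLp (μ := μ) p hK.measurableSet hK.measure_ne_top δ‖ := by
    refine Lp.norm_le_norm_of_ae_le ?_
    filter_upwards [Lp.coeFn_sub (kernelTranslateLp c z f) (kernelTranslateLp c z₀ f),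
      (coeFn_kernelTranslateLp c z f).trans (kernelTranslate_congr_ae c z hfg),
      (coeFn_kernelTranslateLp c z₀ f).trans (kernelTranslate_congr_ae c z₀ hfg),
      indicatorConstLp_coeFn (p := p) (hs := hK.measurableSet) (hμs := hK.measure_ne_top (μ := μ))
        (c := δ)] with w h1 h2 h3 h4
    rw [h1, Pi.sub_apply, h2, h3, h4]
    by_cases hw : w ∈ K
    · rw [Set.indicator_of_mem hw, Real.norm_of_nonneg hδ.le]
      exact (hUW (Set.mk_mem_prod hz (hKW hw))).le
    · simp [hout z hzV w hw, hout z₀ (mem_of_mem_nhds hVz) w hw, hw]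
  refine (hle.trans norm_indicatorConstLp_le).trans_lt ?_
  rw [Real.norm_of_nonneg hδ.le, div_mul_eq_mul_div, div_lt_iff₀ hpos]
  exact mul_lt_mul_of_pos_left (lt_add_one _) hε

/-- Twisted translation is strongly continuous on `L^p`, `p < ∞`. -/
theorem continuous_kernelTranslateLp [LocallyCompactSpace X] [T2Space X] [μ.Regular]
    [Fact (1 ≤ p)] (hp : p ≠ ∞) (c : UnimodularKernel X) (f : Lp E p μ) :
    Continuous fun z => kernelTranslateLp c z f := by
  -- Isometries are uniformly Lipschitz in `f`, so continuity in `z` need only be checked on a dense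
  -- set of `f`.
  have h := continuous_prod_of_dense_continuous_lipschitzWith
    (fun fz : Lp E p μ × X => kernelTranslateLp c fz.2 fz.1) 1
    (dense_compactlySupportedLp (μ := μ) (E := E) hp) ?_
    (fun z => (kernelTranslateLp c z).isometry.lipschitz)
  · exact h.comp (Continuous.prodMk_right f)
  · rintro f ⟨g, hg, hg', hfg⟩
    exact continuous_kernelTranslateLp_of_hasCompactSupport c hg hg' hfg

end Translate

section Conv

/-- The twisted convolution of two functions, with respect to a kernel `c` and a bilinear
map `B`. -/
def kernelConv [MeasurableSpace X] (μ : Measure X) (c : UnimodularKernel X) (B : E →L[ℂ] F →L[ℂ] H)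
    (f : X → E) (g : X → F) (w : X) : H :=
  ∫ z, B (kernelTranslate c z f w) (g z) ∂μ

section Apply

variable {Y : Type*} [MeasurableSpace Y] {μ : Measure Y} {p : ℝ≥0∞} [Fact (1 ≤ p)]

variable (μ p) in
/-- The bilinear map `(f, y) ↦ (w ↦ B (f w) y)` from `L^p × F` to `L^p`. -/
def applyLp (B : E →L[ℂ] F →L[ℂ] H) : Lp E p μ →L[ℂ] F →L[ℂ] Lp H p μ :=
  LinearMap.mkContinuous₂
    (LinearMap.mk₂ ℂ (fun f y => (B.flip y).compLpL p μ f)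
      (fun f g y => map_add _ _ _) (fun a f y => map_smul _ _ _)
      (fun f y y' => by rw [map_add, ContinuousLinearMap.add_compLpL]; rfl)
      (fun a f y => by rw [map_smul, ContinuousLinearMap.smul_compLpL]; rfl))
    ‖B‖ fun f y => by
      refine (((B.flip y).compLpL p μ).le_opNorm f).trans ?_
      rw [mul_right_comm]
      gcongr
      refine (ContinuousLinearMap.norm_compLpL_le _).trans ?_
      exact (B.flip.le_opNorm y).trans_eq (by rw [ContinuousLinearMap.opNorm_flip])

theorem coeFn_applyLp (B : E →L[ℂ] F →L[ℂ] H) (f : Lp E p μ) (y : F) :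
    applyLp μ p B f y =ᵐ[μ] fun w => B (f w) y :=
  (B.flip y).coeFn_compLpL f

theorem norm_applyLp_le (B : E →L[ℂ] F →L[ℂ] H) (f : Lp E p μ) (y : F) :
    ‖applyLp μ p B f y‖ ≤ ‖B‖ * ‖f‖ * ‖y‖ :=
  ((applyLp μ p B).le_opNorm₂ f y).trans (by
    gcongr
    exact LinearMap.mkContinuous₂_norm_le _ (norm_nonneg B) _)

end Apply

variable [IsTopologicalGroup X] [LocallyCompactSpace X] [T2Space X] [MeasurableSpace X]
  [BorelSpace X] {μ : Measure X} [μ.IsHaarMeasure] [μ.Regular] {p : ℝ≥0∞} [Fact (1 ≤ p)]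

/-- Translations are isometric, so the integrand is dominated by a multiple of `‖g z‖`.
Measurability comes from the integrable factor `g`, since the orbit `z ↦ T_z f` alone need not be
strongly measurable. -/
theorem integrable_applyLp_kernelTranslateLp [CompleteSpace F] (hp : p ≠ ∞)
    (c : UnimodularKernel X) (B : E →L[ℂ] F →L[ℂ] H) (f : Lp E p μ) (g : Lp F 1 μ) :
    Integrable (fun z => applyLp μ p B (kernelTranslateLp c z f) (g z)) μ := by
  refine ((L1.integrable_coeFn g).norm.const_mul (‖B‖ * ‖f‖)).mono' ?_ ?_
  · exact aestronglyMeasurable_bilin_of_continuous (D := fun f y => applyLp μ p B f y)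
      (applyLp μ p B).continuous₂ (by simp) (continuous_kernelTranslateLp hp c f) one_ne_top g
  · refine Eventually.of_forall fun z => (norm_applyLp_le B _ _).trans_eq ?_
    rw [LinearIsometry.norm_map]

/-- Twisted convolution as a bilinear map `L^p × L^1 → L^p`. -/
def kernelConvLp [CompleteSpace F] (hp : p ≠ ∞) (c : UnimodularKernel X) (B : E →L[ℂ] F →L[ℂ] H) :
    Lp E p μ →L[ℂ] Lp F 1 μ →L[ℂ] Lp H p μ :=
  LinearMap.mkContinuous₂
    (LinearMap.mk₂ ℂ (fun f g => ∫ z, applyLp μ p B (kernelTranslateLp c z f) (g z) ∂μ)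
      (fun f f' g => by
        rw [← integral_add (integrable_applyLp_kernelTranslateLp hp c B f g)
          (integrable_applyLp_kernelTranslateLp hp c B f' g)]
        simp only [map_add, add_apply])
      (fun a f g => by
        rw [← integral_smul]
        simp only [map_smul, smul_apply])
      (fun f g g' => by
        rw [← integral_add (integrable_applyLp_kernelTranslateLp hp c B f g)
          (integrable_applyLp_kernelTranslateLp hp c B f g')]
        refine integral_congr_ae ?_
        filter_upwards [Lp.coeFn_add g g'] with z hz
        rw [hz, Pi.add_apply, map_add])
      (fun a f g => by
        rw [← integral_smul]
        refine integral_congr_ae ?_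
        filter_upwards [Lp.coeFn_smul a g] with z hz
        rw [hz, Pi.smul_apply, map_smul]))
    ‖B‖ fun f g => by
      refine (norm_integral_le_of_norm_le
        ((L1.integrable_coeFn g).norm.const_mul (‖B‖ * ‖f‖)) ?_).trans_eq ?_
      · refine Eventually.of_forall fun z => (norm_applyLp_le B _ _).trans_eq ?_
        rw [LinearIsometry.norm_map]
      · rw [integral_const_mul, L1.norm_eq_integral_norm]

theorem kernelConvLp_eq_integral [CompleteSpace F] (hp : p ≠ ∞) (c : UnimodularKernel X)
    (B : E →L[ℂ] F →L[ℂ] H) (f : Lp E p μ) (g : Lp F 1 μ) :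
    kernelConvLp hp c B f g = ∫ z, applyLp μ p B (kernelTranslateLp c z f) (g z) ∂μ := rfl

theorem norm_kernelConvLp_le [CompleteSpace F] (hp : p ≠ ∞) (c : UnimodularKernel X)
    (B : E →L[ℂ] F →L[ℂ] H) (f : Lp E p μ) (g : Lp F 1 μ) :
    ‖kernelConvLp hp c B f g‖ ≤ ‖B‖ * ‖f‖ * ‖g‖ :=
  ((kernelConvLp hp c B).le_opNorm₂ f g).trans (by
    gcongr
    exact LinearMap.mkContinuous₂_norm_le _ (norm_nonneg B) _)

end Conv

end

/-! ### The pointwise formula for the `L^p`-valued convolution -/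

section

section Bilinear

variable {E F H : Type*} [NormedAddCommGroup E] [NormedSpace ℂ E]
  [NormedAddCommGroup F] [NormedSpace ℂ F] [NormedAddCommGroup H] [NormedSpace ℂ H]

theorem hasSum_bilin_of_summable_norm [CompleteSpace H] (L : E →L[ℂ] F →L[ℂ] H) {u : ℕ → E}
    {v : ℕ → F} {a : E} {b : F} (hu : Summable fun n => ‖u n‖) (hv : Summable fun n => ‖v n‖)
    (ha : HasSum u a) (hb : HasSum v b) :
    HasSum (fun i : ℕ × ℕ => L (u i.1) (v i.2)) (L a b) := by
  have hs : Summable fun i : ℕ × ℕ => L (u i.1) (v i.2) := by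
    refine Summable.of_norm_bounded
      ((hu.mul_of_nonneg hv (fun _ => norm_nonneg _) fun _ => norm_nonneg _).mul_left ‖L‖)
      fun i => (L.le_opNorm₂ _ _).trans_eq (mul_assoc _ _ _)
  have h1 := hs.hasSum.prod_fiberwise fun n => (L (u n)).hasSum hb
  have h2 : HasSum (fun n => L (u n) b) (L a b) := (L.flip b).hasSum ha
  exact h1.unique h2 ▸ hs.hasSum

end Bilinear

section SetIntegral

variable {Y : Type*} [MeasurableSpace Y] {μ : Measure Y} {p : ℝ≥0∞} [Fact (1 ≤ p)]
  {H : Type*} [NormedAddCommGroup H] [NormedSpace ℂ H] [CompleteSpace H]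

/-- Integration over a set of finite measure is a continuous linear map on `L^p`. -/
theorem exists_clm_eq_setIntegral {s : Set Y} (hs : MeasurableSet s) (hμs : μ s ≠ ∞) :
    ∃ L : Lp H p μ →L[ℂ] H, ∀ f : Lp H p μ, L f = ∫ w in s, f w ∂μ := by
  have hpq : HolderConjugate p p.conjExponent := HolderConjugate.conjExponent Fact.out
  have : HolderConjugate p.conjExponent p := hpq.symm
  have : Fact (1 ≤ p.conjExponent) := ⟨HolderConjugate.one_le p.conjExponent p⟩
  -- Integration over `s` is the Hölder pairing with the indicator of `s`, which lies in every `L^r`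
  -- as `s` has finite measure.
  refine ⟨(ContinuousLinearMap.lsmul ℂ ℂ).lpPairing μ p.conjExponent p
    (indicatorConstLp _ hs hμs (1 : ℂ)), fun f => ?_⟩
  rw [ContinuousLinearMap.lpPairing_eq_integral, ← integral_indicator hs]
  refine integral_congr_ae ?_
  filter_upwards [indicatorConstLp_coeFn (p := p.conjExponent) (hs := hs) (hμs := hμs)
    (c := (1 : ℂ))] with w hw
  rw [hw]
  by_cases h : w ∈ s <;> simp [h]

end SetIntegral

variable {X : Type*} [CommGroup X] [TopologicalSpace X] [IsTopologicalGroup X]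
  {E F H : Type*} [NormedAddCommGroup E] [NormedSpace ℂ E]
  [NormedAddCommGroup F] [NormedSpace ℂ F] [NormedAddCommGroup H] [NormedSpace ℂ H]
  {c : UnimodularKernel X} {B : E →L[ℂ] F →L[ℂ] H}

section CompactSupport

variable {f : X → E} {g : X → F}

theorem continuous_kernelConv_integrand (hf : Continuous f) (hg : Continuous g) :
    Continuous (uncurry fun w z => B (kernelTranslate c z f w) (g z)) := by
  have h : Continuous fun x : X × X => kernelTranslate c x.2 f x.1 :=
    (c.continuous_comp (by fun_prop) (by fun_prop)).smul (hf.comp (by fun_prop))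
  exact B.continuous₂.comp (h.prodMk (hg.comp continuous_snd))

omit [IsTopologicalGroup X] in
theorem kernelConv_integrand_eq_zero {w z : X}
    (h : w ∉ tsupport f * tsupport g ∨ z ∉ tsupport g) :
    B (kernelTranslate c z f w) (g z) = 0 := by
  by_cases hz : z ∈ tsupport g
  · have hw : w / z ∉ tsupport f := fun hw =>
      h.resolve_right (not_not.2 hz) ⟨_, hw, z, hz, div_mul_cancel w z⟩
    simp [kernelTranslate, image_eq_zero_of_notMem_tsupport hw]
  · simp [image_eq_zero_of_notMem_tsupport hz]

theorem hasCompactSupport_kernelConv_integrand (hf : HasCompactSupport f)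
    (hg : HasCompactSupport g) :
    HasCompactSupport (uncurry fun w z => B (kernelTranslate c z f w) (g z)) := by
  refine HasCompactSupport.intro ((hf.isCompact.mul hg.isCompact).prod hg.isCompact) ?_
  rintro ⟨w, z⟩ h
  refine kernelConv_integrand_eq_zero ?_
  rwa [Set.mem_prod, not_and_or] at h

variable [MeasurableSpace X] (μ : Measure X)

theorem continuous_kernelConv [BorelSpace X] [IsFiniteMeasureOnCompacts μ] (hf : Continuous f) (hg : Continuous g)
    (hg' : HasCompactSupport g) : Continuous (kernelConv μ c B f g) := by
  rw [← continuousOn_univ]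
  refine continuousOn_integral_of_compact_support hg'.isCompact
    (continuous_kernelConv_integrand hf hg).continuousOn fun w z _ hz => ?_
  exact kernelConv_integrand_eq_zero (.inr hz)

theorem hasCompactSupport_kernelConv (hf' : HasCompactSupport f) (hg' : HasCompactSupport g) :
    HasCompactSupport (kernelConv μ c B f g) := by
  refine HasCompactSupport.intro (hf'.isCompact.mul hg'.isCompact) fun w hw => ?_
  rw [kernelConv]
  simp only [kernelConv_integrand_eq_zero (.inl hw), integral_zero]

end CompactSupport

variable [LocallyCompactSpace X] [T2Space X] [MeasurableSpace X]
  [BorelSpace X] {μ : Measure X} [μ.IsHaarMeasure] [μ.Regular] {p : ℝ≥0∞} [Fact (1 ≤ p)]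
  [CompleteSpace F] [CompleteSpace H]

/-- Both sides have the same integral over every set of finite measure: such an integral is a
continuous linear map, hence passes under the Bochner integral, and the order of integration is then
exchanged. -/
theorem coeFn_kernelConvLp_of_hasCompactSupport (hp : p ≠ ∞) {f : Lp E p μ} {g : Lp F 1 μ}
    {γ : X → E} {η : X → F} (hγ : Continuous γ) (hγ' : HasCompactSupport γ) (hfγ : f =ᵐ[μ] γ)
    (hη : Continuous η) (hη' : HasCompactSupport η) (hgη : g =ᵐ[μ] η) :
    kernelConvLp hp c B f g =ᵐ[μ] kernelConv μ c B γ η := by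
  have hk : MemLp (kernelConv μ c B γ η) p μ :=
    (continuous_kernelConv μ hγ hη hη').memLp_of_hasCompactSupport
      (hasCompactSupport_kernelConv μ hγ' hη')
  refine EventuallyEq.trans ?_ hk.coeFn_toLp
  have hint (h : Lp H p μ) (s : Set X) (hs : MeasurableSet s) (hμs : μ s < ∞) :
      IntegrableOn h s μ :=
    integrableOn_Lp_of_measure_ne_top h Fact.out hμs.ne
  refine Lp.ae_eq_of_forall_setIntegral_eq _ _ (zero_lt_one.trans_le Fact.out).ne' hp (hint _)
    (hint _) fun s hs hμs => ?_
  obtain ⟨L, hL⟩ := exists_clm_eq_setIntegral (μ := μ) (p := p) (H := H) hs hμs.ne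
  rw [setIntegral_congr_ae (g := kernelConv μ c B γ η) hs
    (hk.coeFn_toLp.mono fun w hw _ => hw), ← hL, kernelConvLp_eq_integral,
    ← L.integral_comp_comm (integrable_applyLp_kernelTranslateLp hp c B f g)]
  simp only [kernelConv]
  -- This form of Fubini needs no σ-finiteness: the integrand is continuous with compact support.
  rw [integral_integral_swap_of_hasCompactSupport (continuous_kernelConv_integrand hγ hη)
    (hasCompactSupport_kernelConv_integrand hγ' hη')]
  refine integral_congr_ae ?_
  filter_upwards [hgη] with z hz
  rw [hL]
  refine setIntegral_congr_ae hs ?_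
  filter_upwards [coeFn_applyLp B (kernelTranslateLp c z f) (g z), coeFn_kernelTranslateLp c z f,
    kernelTranslate_congr_ae c z hfγ] with w h1 h2 h3 _
  rw [h1, h2, h3, hz]

-- The equality holds at every `w`, because `z ↦ w / z` preserves the measure.
omit [T2Space X] [CompleteSpace F] [CompleteSpace H] in
theorem kernelConv_congr_ae {f f' : X → E} {g g' : X → F} (hf : f =ᵐ[μ] f') (hg : g =ᵐ[μ] g') :
    kernelConv μ c B f g = kernelConv μ c B f' g' := by
  ext w
  refine integral_congr_ae ?_
  filter_upwards [(Measure.measurePreserving_div_left μ w).quasiMeasurePreserving.ae_eq_comp hf, hg]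
    with z h1 h2
  simp only [comp_apply] at h1
  simp only [kernelTranslate, h1, h2]

-- The majorant for exchanging sum and integral in `coeFn_kernelConvLp`. The integrals are untwisted
-- convolutions of `‖γ i‖` and `‖η j‖`, with `L^p` norms bounded by a summable family of products; a
-- norm-summable family in `L^p` converges absolutely almost everywhere.
omit [NormedSpace ℂ E] [NormedSpace ℂ F] [CompleteSpace F] [CompleteSpace H] in
theorem ae_summable_integral_norm_mul_norm (hp : p ≠ ∞) {γ : ℕ → X → E} {η : ℕ → X → F}
    (hγ : ∀ n, Continuous (γ n)) (hγ' : ∀ n, HasCompactSupport (γ n))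
    (hη : ∀ n, Continuous (η n)) (hη' : ∀ n, HasCompactSupport (η n))
    (hγs : Summable fun n => (eLpNorm (γ n) p μ).toReal)
    (hηs : Summable fun n => (eLpNorm (η n) 1 μ).toReal) :
    ∀ᵐ w ∂μ, Summable fun i : ℕ × ℕ => ∫ z, ‖γ i.1 (w / z)‖ * ‖η i.2 z‖ ∂μ := by
  have hu (n : ℕ) : Continuous fun x => (‖γ n x‖ : ℂ) := Complex.continuous_ofReal.comp (hγ n).norm
  have hv (n : ℕ) : Continuous fun x => (‖η n x‖ : ℂ) := Complex.continuous_ofReal.comp (hη n).norm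
  have hu' (n : ℕ) : HasCompactSupport fun x => (‖γ n x‖ : ℂ) :=
    (hγ' n).comp_left (g := fun y => ((‖y‖ : ℝ) : ℂ)) (by simp)
  have hv' (n : ℕ) : HasCompactSupport fun x => (‖η n x‖ : ℂ) :=
    (hη' n).comp_left (g := fun y => ((‖y‖ : ℝ) : ℂ)) (by simp)
  let U (n : ℕ) : Lp ℂ p μ := ((hu n).memLp_of_hasCompactSupport (hu' n)).toLp _
  let V (n : ℕ) : Lp ℂ 1 μ := ((hv n).memLp_of_hasCompactSupport (hv' n)).toLp _
  have hU (n : ℕ) : ‖U n‖ = (eLpNorm (γ n) p μ).toReal := by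
    rw [Lp.norm_toLp]
    exact congrArg _ (eLpNorm_congr_norm_ae (by simp))
  have hV (n : ℕ) : ‖V n‖ = (eLpNorm (η n) 1 μ).toReal := by
    rw [Lp.norm_toLp]
    exact congrArg _ (eLpNorm_congr_norm_ae (by simp))
  let N (i : ℕ × ℕ) : Lp ℂ p μ :=
    kernelConvLp hp (UnimodularKernel.one X) (ContinuousLinearMap.mul ℂ ℂ) (U i.1) (V i.2)
  have hN (i : ℕ × ℕ) : N i =ᵐ[μ] fun w => ((∫ z, ‖γ i.1 (w / z)‖ * ‖η i.2 z‖ ∂μ : ℝ) : ℂ) := by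
    refine (coeFn_kernelConvLp_of_hasCompactSupport hp (hu i.1) (hu' i.1) (MemLp.coeFn_toLp _)
      (hv i.2) (hv' i.2) (MemLp.coeFn_toLp _)).trans (Eventually.of_forall fun w => ?_)
    simp [kernelConv, kernelTranslate, UnimodularKernel.one, ← integral_complex_ofReal]
  have hNs : Summable fun i => ‖N i‖ := by
    refine Summable.of_nonneg_of_le (fun _ => norm_nonneg _)
      (fun i => norm_kernelConvLp_le _ _ _ _ _) ?_
    simp only [hU, hV, mul_assoc]
    exact (hγs.mul_of_nonneg hηs (fun _ => toReal_nonneg) fun _ => toReal_nonneg).mul_left _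
  have hs := summable_norm_of_tsum_eLpNorm_ne_top (p := p) Fact.out
    (fun i => Lp.aestronglyMeasurable (N i))
    (by simpa only [← Lp.enorm_def] using tsum_enorm_ne_top_iff_summable_norm.2 hNs)
  filter_upwards [hs, ae_all_iff.2 hN] with w hw hNw
  simp only [hNw] at hw
  refine hw.congr fun i => ?_
  rw [Complex.norm_real, Real.norm_of_nonneg (integral_nonneg fun z => by positivity)]

/-- The `L^p`-valued integral `kernelConvLp` is given pointwise by `kernelConv`. -/
theorem coeFn_kernelConvLp [CompleteSpace E] (hp : p ≠ ∞) (c : UnimodularKernel X)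
    (B : E →L[ℂ] F →L[ℂ] H) (f : Lp E p μ) (g : Lp F 1 μ) :
    kernelConvLp hp c B f g =ᵐ[μ] kernelConv μ c B f g := by
  obtain ⟨v, γ, hγ, hγ', hvγ, hvs, hvf⟩ := exists_hasSum_hasCompactSupport hp f
  obtain ⟨u, η, hη, hη', huη, hus, hug⟩ := exists_hasSum_hasCompactSupport one_ne_top g
  have hγs : Summable fun n => (eLpNorm (γ n) p μ).toReal :=
    hvs.congr fun n => by rw [Lp.norm_def, eLpNorm_congr_ae (hvγ n)]
  have hηs : Summable fun n => (eLpNorm (η n) 1 μ).toReal :=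
    hus.congr fun n => by rw [Lp.norm_def, eLpNorm_congr_ae (huη n)]
  have hsum := hasSum_bilin_of_summable_norm (kernelConvLp hp c B) hvs hus hvf hug
  have hsumn : Summable fun i : ℕ × ℕ => ‖kernelConvLp hp c B (v i.1) (u i.2)‖ := by
    refine Summable.of_nonneg_of_le (fun _ => norm_nonneg _)
      (fun i => norm_kernelConvLp_le _ _ _ _ _) ?_
    simp only [mul_assoc]
    exact (hvs.mul_of_nonneg hus (fun _ => norm_nonneg _) fun _ => norm_nonneg _).mul_left _
  have h1 := Lp.hasSum_coeFn_tsum (tsum_enorm_ne_top_iff_summable_norm.2 hsumn)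
  have h2 : ∀ᵐ w ∂μ, ∀ i : ℕ × ℕ,
      kernelConvLp hp c B (v i.1) (u i.2) w = kernelConv μ c B (γ i.1) (η i.2) w :=
    ae_all_iff.2 fun i => coeFn_kernelConvLp_of_hasCompactSupport hp (hγ i.1) (hγ' i.1) (hvγ i.1)
      (hη i.2) (hη' i.2) (huη i.2)
  have hf : ∀ᵐ x ∂μ, (Summable fun n => ‖γ n x‖) ∧ HasSum (fun n => γ n x) (f x) := by
    have hvs' := tsum_enorm_ne_top_iff_summable_norm.2 hvs
    filter_upwards [Lp.hasSum_coeFn_tsum hvs', ae_all_iff.2 hvγ,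
      summable_norm_of_tsum_eLpNorm_ne_top (p := p) Fact.out
        (fun i => Lp.aestronglyMeasurable (v i)) (by simpa only [← Lp.enorm_def] using hvs')]
      with x hx hx' hx''
    simp only [hx', hvf.tsum_eq] at hx hx''
    exact ⟨hx'', hx⟩
  have hg : ∀ᵐ x ∂μ, (Summable fun n => ‖η n x‖) ∧ HasSum (fun n => η n x) (g x) := by
    have hus' := tsum_enorm_ne_top_iff_summable_norm.2 hus
    filter_upwards [Lp.hasSum_coeFn_tsum hus', ae_all_iff.2 huη,
      summable_norm_of_tsum_eLpNorm_ne_top (p := 1) le_rfl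
        (fun i => Lp.aestronglyMeasurable (u i)) (by simpa only [← Lp.enorm_def] using hus')]
      with x hx hx' hx''
    simp only [hx', hug.tsum_eq] at hx hx''
    exact ⟨hx'', hx⟩
  filter_upwards [h1, h2, ae_summable_integral_norm_mul_norm hp hγ hγ' hη hη' hγs hηs]
    with w hw1 hw2 hw3
  rw [hsum.tsum_eq] at hw1
  simp only [hw2] at hw1
  have hi (i : ℕ × ℕ) :
      Integrable (fun z => B (kernelTranslate c z (γ i.1) w) (η i.2 z)) μ := by
    refine Continuous.integrable_of_hasCompactSupport ?_ ?_
    · exact (continuous_kernelConv_integrand (hγ i.1) (hη i.2)).comp (Continuous.prodMk_right w)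
    · exact HasCompactSupport.intro (hη' i.2).isCompact fun z hz =>
        kernelConv_integrand_eq_zero (.inr hz)
  have hin (i : ℕ × ℕ) : Integrable (fun z => ‖γ i.1 (w / z)‖ * ‖η i.2 z‖) μ := by
    refine Continuous.integrable_of_hasCompactSupport ?_ ?_
    · exact ((hγ i.1).comp (by fun_prop)).norm.mul (hη i.2).norm
    · exact (hη' i.2).norm.mul_left
  have hs : Summable fun i : ℕ × ℕ =>
      ∫ z, ‖B (kernelTranslate c z (γ i.1) w) (η i.2 z)‖ ∂μ := by
    refine Summable.of_nonneg_of_le (fun i => integral_nonneg fun z => norm_nonneg _) (fun i => ?_)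
      (hw3.mul_left ‖B‖)
    rw [← integral_const_mul]
    refine integral_mono (hi i).norm ((hin i).const_mul _) fun z => ?_
    refine (B.le_opNorm₂ _ _).trans_eq ?_
    rw [kernelTranslate, norm_smul, c.norm_apply, one_mul, mul_assoc]
  -- At this `w` the double series can be integrated term by term, so it remains to sum it under the
  -- integral sign.
  have hw4 := hasSum_integral_of_summable_integral_norm hi hs
  rw [hw1.unique hw4, kernelConv]
  refine integral_congr_ae ?_
  filter_upwards [(Measure.measurePreserving_div_left μ w).quasiMeasurePreserving.ae hf, hg]
    with z hz1 hz2
  refine (hasSum_bilin_of_summable_norm B (u := fun n => kernelTranslate c z (γ n) w)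
    (a := kernelTranslate c z f w) ?_ hz2.1 ?_ hz2.2).tsum_eq
  · simpa only [kernelTranslate, norm_smul, c.norm_apply, one_mul] using hz1.1
  · exact hz1.2.const_smul _

end

/-! ### Commuting with translations versus commuting with convolution -/

section

variable {X : Type*} [CommGroup X] [TopologicalSpace X] [IsTopologicalGroup X]
  [LocallyCompactSpace X] [MeasurableSpace X] [BorelSpace X]
  {μ : Measure X} [μ.IsHaarMeasure] [μ.Regular] {p : ℝ≥0∞} [Fact (1 ≤ p)]
  {E F H : Type*} [NormedAddCommGroup E] [NormedSpace ℂ E]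
  [NormedAddCommGroup F] [NormedSpace ℂ F] [NormedAddCommGroup H] [NormedSpace ℂ H]

/-- The substitution `z ↦ w / z` exchanges the two arguments of `c (w / z) z`. In this way
statements about the second factor of a convolution also apply to the first. -/
theorem kernelConv_swap (c : UnimodularKernel X) (B : E →L[ℂ] F →L[ℂ] H) (f : X → E) (g : X → F) :
    kernelConv μ c B f g = kernelConv μ c.swap B.flip g f := by
  ext w
  rw [kernelConv, kernelConv, ← integral_div_left_eq_self _ μ w]
  refine integral_congr_ae (Eventually.of_forall fun z => ?_)
  simp [kernelTranslate, UnimodularKernel.swap]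

variable [T2Space X]

theorem kernelConvLp_swap [CompleteSpace E] [CompleteSpace F] [CompleteSpace H]
    (c : UnimodularKernel X) (B : E →L[ℂ] F →L[ℂ] H) (f : Lp E 1 μ) (g : Lp F 1 μ) :
    kernelConvLp one_ne_top c B f g = kernelConvLp one_ne_top c.swap B.flip g f := by
  refine Lp.ext ((coeFn_kernelConvLp _ c B f g).trans ?_)
  rw [kernelConv_swap]
  exact (coeFn_kernelConvLp _ c.swap B.flip g f).symm

/-- An operator that commutes with twisted translations and with `B · y` commutes with twisted
convolution. -/
theorem map_kernelConvLp [CompleteSpace F] [CompleteSpace H] {r : ℝ≥0∞} [Fact (1 ≤ r)] (hp : p ≠ ∞)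
    (hr : r ≠ ∞) {c : UnimodularKernel X} {B : E →L[ℂ] F →L[ℂ] H} {S : Lp E p μ →L[ℂ] Lp E r μ}
    {T : Lp H p μ →L[ℂ] Lp H r μ}
    (hT : ∀ z f y, T (applyLp μ p B (kernelTranslateLp c z f) y) =
      applyLp μ r B (kernelTranslateLp c z (S f)) y) (f : Lp E p μ) (g : Lp F 1 μ) :
    T (kernelConvLp hp c B f g) = kernelConvLp hr c B (S f) g := by
  rw [kernelConvLp_eq_integral, kernelConvLp_eq_integral,
    ← T.integral_comp_comm (integrable_applyLp_kernelTranslateLp hp c B f g)]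
  simp only [hT]

variable (μ) in
/-- The normalised indicator function of the compact set `K`, multiplied by the vector `y`. -/
def averageLp {K : Set X} (hK : IsCompact K) (y : F) : Lp F 1 μ :=
  indicatorConstLp 1 hK.measurableSet hK.measure_ne_top ((μ.real K : ℂ)⁻¹ • y)

omit [IsTopologicalGroup X] [LocallyCompactSpace X] [μ.Regular] in
theorem norm_averageLp_le {K : Set X} (hK : IsCompact K) (y : F) : ‖averageLp μ hK y‖ ≤ ‖y‖ := by
  refine norm_indicatorConstLp_le.trans ?_
  rw [norm_smul, norm_inv, Complex.norm_real, Real.norm_of_nonneg measureReal_nonneg, toReal_one,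
    div_one, Real.rpow_one, mul_right_comm]
  exact mul_le_of_le_one_left (norm_nonneg _) (inv_mul_le_one_of_le₀ le_rfl measureReal_nonneg)

theorem kernelConvLp_averageLp [CompleteSpace F] (hp : p ≠ ∞)
    (c : UnimodularKernel X) (B : E →L[ℂ] F →L[ℂ] H) (f : Lp E p μ) {K : Set X} (hK : IsCompact K)
    (y : F) :
    kernelConvLp hp c B f (averageLp μ hK y) =
      ⨍ z in K, applyLp μ p B (kernelTranslateLp c z f) y ∂μ := by
  rw [kernelConvLp_eq_integral, setAverage_eq, ← integral_smul,
    ← integral_indicator hK.measurableSet]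
  refine integral_congr_ae ?_
  have h : averageLp μ hK y =ᵐ[μ] _ := indicatorConstLp_coeFn
  filter_upwards [h] with z hz
  rw [hz]
  by_cases hzK : z ∈ K
  · simp only [Set.indicator_of_mem hzK, map_smul]
    rw [← Complex.ofReal_inv, Complex.coe_smul]
    rfl
  · simp [hzK]

/-- Convolution with an average over a small compact neighbourhood of `z₀` approximates twisted
translation by `z₀`. -/
theorem norm_kernelConvLp_averageLp_sub_le [CompleteSpace F] [CompleteSpace H] (hp : p ≠ ∞)
    (c : UnimodularKernel X) (B : E →L[ℂ] F →L[ℂ] H) (f : Lp E p μ) {K : Set X} (hK : IsCompact K)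
    (hK0 : μ K ≠ 0) (y : F) {g : Lp E p μ} {δ : ℝ}
    (h : ∀ z ∈ K, ‖kernelTranslateLp c z f - g‖ ≤ δ) :
    ‖kernelConvLp hp c B f (averageLp μ hK y) - applyLp μ p B g y‖ ≤ ‖B‖ * δ * ‖y‖ := by
  rw [kernelConvLp_averageLp, ← mem_closedBall_iff_norm]
  -- An average of points of a closed ball lies in that ball.
  refine (convex_closedBall _ _).set_average_mem Metric.isClosed_closedBall hK0 hK.measure_ne_top ?_
    ?_
  · refine (ae_restrict_iff' hK.measurableSet).2 (Eventually.of_forall fun z hz => ?_)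
    rw [mem_closedBall_iff_norm, ← sub_apply, ← map_sub]
    refine (norm_applyLp_le B _ y).trans ?_
    gcongr
    exact h z hz
  · refine ContinuousOn.integrableOn_compact hK (Continuous.continuousOn ?_)
    exact ((applyLp μ p B).flip y).continuous.comp (continuous_kernelTranslateLp hp c f)

theorem eventually_norm_kernelTranslateLp_sub_le (hp : p ≠ ∞) (c : UnimodularKernel X)
    (f : Lp E p μ) (z₀ : X) {δ : ℝ} (hδ : 0 < δ) :
    ∀ᶠ z in 𝓝 z₀, ‖kernelTranslateLp c z f - kernelTranslateLp c z₀ f‖ ≤ δ := by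
  filter_upwards [Metric.tendsto_nhds.1 ((continuous_kernelTranslateLp hp c f).tendsto z₀) δ hδ]
    with z hz
  exact (dist_eq_norm _ _).symm.trans_le hz.le

/-- If `T` commutes with twisted convolution on the right, it commutes with twisted translations
followed by `B · y`. -/
theorem map_applyLp_kernelTranslateLp [CompleteSpace F] [CompleteSpace H] {r : ℝ≥0∞} [Fact (1 ≤ r)]
    (hp : p ≠ ∞) (hr : r ≠ ∞) {c : UnimodularKernel X} {B : E →L[ℂ] F →L[ℂ] H}
    {S : Lp E p μ →L[ℂ] Lp E r μ} {T : Lp H p μ →L[ℂ] Lp H r μ} {f : Lp E p μ}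
    (hT : ∀ g : Lp F 1 μ, T (kernelConvLp hp c B f g) = kernelConvLp hr c B (S f) g) (z : X)
    (y : F) :
    T (applyLp μ p B (kernelTranslateLp c z f) y) =
      applyLp μ r B (kernelTranslateLp c z (S f)) y := by
  rw [← sub_eq_zero, ← norm_le_zero_iff]
  refine le_of_forall_pos_le_add fun ε hε => ?_
  -- The approximation errors before and after applying `T` add up to `M * δ`; one set `K` is chosen
  -- small enough for both `f` and `S f`.
  set M : ℝ := (‖T‖ + 1) * ‖B‖ * ‖y‖
  have hM : 0 ≤ M := by positivity
  set δ : ℝ := ε / (M + 1)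
  have hδ : 0 < δ := by positivity
  obtain ⟨K, hKz, hKs, hK⟩ := local_compact_nhds
    ((eventually_norm_kernelTranslateLp_sub_le hp c f z hδ).and
      (eventually_norm_kernelTranslateLp_sub_le hr c (S f) z hδ))
  have hK0 : μ K ≠ 0 := (Measure.measure_pos_of_mem_nhds μ hKz).ne'
  have h1 := norm_kernelConvLp_averageLp_sub_le hp c B f hK hK0 y fun w hw => (hKs hw).1
  have h2 := norm_kernelConvLp_averageLp_sub_le hr c B (S f) hK hK0 y fun w hw => (hKs hw).2
  rw [← hT] at h2
  calc _ ≤ ‖T (applyLp μ p B (kernelTranslateLp c z f) y) -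
          T (kernelConvLp hp c B f (averageLp μ hK y))‖ +
        ‖T (kernelConvLp hp c B f (averageLp μ hK y)) -
          applyLp μ r B (kernelTranslateLp c z (S f)) y‖ := norm_sub_le_norm_sub_add_norm_sub _ _ _
    _ ≤ ‖T‖ * (‖B‖ * δ * ‖y‖) + ‖B‖ * δ * ‖y‖ := by
        refine add_le_add ?_ h2
        rw [← map_sub, norm_sub_rev] at *
        refine (T.le_opNorm _).trans ?_
        gcongr
    _ = M * δ := by ring
    _ ≤ 0 + ε := by
        rw [zero_add, ← mul_div_assoc, div_le_iff₀ (by positivity)]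
        nlinarith

end

section

/-! ### Reflection: writing `⊕` as a convolution -/

section Reflect

variable {X : Type*} [CommGroup X] [TopologicalSpace X] [IsTopologicalGroup X]

/-- The kernel `(u, v) ↦ c (u v, v⁻¹)`. -/
def UnimodularKernel.reflect (c : UnimodularKernel X) : UnimodularKernel X :=
  ⟨fun u v => c (u * v) v⁻¹, c.continuous_comp (by fun_prop) (by fun_prop),
    fun _ _ => c.norm_apply _ _⟩

variable [LocallyCompactSpace X] [MeasurableSpace X] [BorelSpace X]
  {μ : Measure X} [μ.IsHaarMeasure] [μ.Regular] {p : ℝ≥0∞} [Fact (1 ≤ p)]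
  {E F H : Type*} [NormedAddCommGroup E] [NormedSpace ℂ E]
  [NormedAddCommGroup F] [NormedSpace ℂ F] [NormedAddCommGroup H] [NormedSpace ℂ H]

/-- Substitute `w = z / v`. For `phaseKernel` the right side is `f ⊕ h`, so `⊕` inherits its bounds
and measurability from the convolution of `h` with the reflection of `f`. -/
theorem kernelConv_reflect (c : UnimodularKernel X) (B : F →L[ℂ] E →L[ℂ] H) (f : X → F) (h : X → E)
    (z : X) :
    kernelConv μ c.reflect B.flip h (fun v => f v⁻¹) z =
      ∫ w, B (c z (w / z) • f (w / z)) (h w) ∂μ := by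
  rw [kernelConv, ← integral_div_left_eq_self (fun w => B (c z (w / z) • f (w / z)) (h w)) μ z]
  refine integral_congr_ae (Eventually.of_forall fun v => ?_)
  simp [kernelTranslate, UnimodularKernel.reflect]

variable (μ p E) in
/-- The isometry `f ↦ (x ↦ f x⁻¹)` of `L^p`. -/
def invLp : Lp E p μ →ₗᵢ[ℂ] Lp E p μ :=
  Lp.compMeasurePreservingₗᵢ ℂ Inv.inv (Measure.measurePreserving_inv μ)

theorem coeFn_invLp (f : Lp E p μ) : invLp μ p E f =ᵐ[μ] fun x => f x⁻¹ :=
  Lp.coeFn_compMeasurePreserving f (Measure.measurePreserving_inv μ)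

end Reflect

/-! ### The approximate identity of `A` acting on `L^p` -/

section ApproximateUnit

variable {A : Type*} [NonUnitalNormedCommRing A] [NormedSpace ℂ A] [IsScalarTower ℂ A A]
  [SMulCommClass ℂ A A] {G : Type*} [CommGroup G] [TopologicalSpace G]
  {μ : Measure (PhaseSpace G)} {p : ℝ≥0∞} [Fact (1 ≤ p)]

theorem norm_lmulLp_le (a : A) (f : Lp A p μ) : ‖lmulLp a f‖ ≤ ‖a‖ * ‖f‖ :=
  (ContinuousLinearMap.norm_compLp_le _ f).trans (by
    gcongr
    exact ContinuousLinearMap.opNorm_mul_apply_le ℂ A a)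

theorem coeFn_lmulLp (a : A) (f : Lp A p μ) : lmulLp a f =ᵐ[μ] fun w => a * f w :=
  ContinuousLinearMap.coeFn_compLpL _ f

theorem lmulLp_eq_rmulLp (a : A) : lmulLp (μ := μ) (p := p) a = rmulLp a := by
  rw [lmulLp, rmulLp]
  congr 1
  ext b
  exact mul_comm _ _

theorem lmulLp_indicatorConstLp (a b : A) {s : Set (PhaseSpace G)} (hs : MeasurableSet s)
    (hμs : μ s ≠ ∞) :
    lmulLp a (indicatorConstLp p hs hμs b) = indicatorConstLp p hs hμs (a * b) := by
  refine Lp.ext ?_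
  filter_upwards [coeFn_lmulLp a (indicatorConstLp p hs hμs b),
    indicatorConstLp_coeFn (p := p) (hs := hs) (hμs := hμs) (c := b),
    indicatorConstLp_coeFn (p := p) (hs := hs) (hμs := hμs) (c := a * b)] with w h1 h2 h3
  rw [h1, h2, h3]
  by_cases hw : w ∈ s <;> simp [hw]

/-- A bounded approximate identity of `A` acts as an approximate identity on `L^p`. -/
theorem tendsto_lmulLp (hp : p ≠ ∞) {l : Filter A} {C : ℝ} (hl : l.IsApproximateUnit)
    (hC : ∀ᶠ e in l, ‖e‖ ≤ C) (f : Lp A p μ) : Tendsto (fun e => lmulLp e f) l (𝓝 f) := by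
  induction f using Lp.induction hp with
  | @indicatorConst c s hs hμs =>
    simp only [Lp.simpleFunc.coe_indicatorConst, lmulLp_indicatorConstLp]
    rw [tendsto_iff_norm_sub_tendsto_zero]
    have h := (tendsto_iff_norm_sub_tendsto_zero.1 (hl.tendsto_mul_right c)).mul_const
      (μ.real s ^ (1 / p.toReal))
    rw [zero_mul] at h
    refine squeeze_zero (fun _ => norm_nonneg _) (fun e => ?_) h
    rw [indicatorConstLp_sub]
    exact norm_indicatorConstLp_le
  | add hf hg _ h1 h2 => simpa only [map_add] using h1.add h2
  | isClosed =>
    refine isClosed_of_closure_subset fun f hf => Metric.tendsto_nhds.2 fun ε hε => ?_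
    have hC' : 0 < |C| + 2 := by positivity
    -- Three errors occur: `e (f - g)`, weighted by `|C|`, and `e g - g` and `f - g`, weighted by
    -- `1` each.
    obtain ⟨g, hg, hfg⟩ := Metric.mem_closure_iff.1 hf (ε / (|C| + 2)) (by positivity)
    filter_upwards [Metric.tendsto_nhds.1 hg (ε / (|C| + 2)) (by positivity), hC] with e h1 h2
    rw [dist_eq_norm] at hfg h1 ⊢
    have h3 : ‖lmulLp e (f - g)‖ ≤ |C| * (ε / (|C| + 2)) :=
      (norm_lmulLp_le e _).trans (mul_le_mul (h2.trans (le_abs_self C)) hfg.le (norm_nonneg _)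
        (abs_nonneg C))
    have h4 : lmulLp e f - f = lmulLp e (f - g) + (lmulLp e g - g) - (f - g) := by
      rw [map_sub]; abel
    rw [h4]
    refine (norm_sub_le _ _).trans_lt ((add_le_add_left (norm_add_le _ _) _).trans_lt ?_)
    have h5 : ε = |C| * (ε / (|C| + 2)) + ε / (|C| + 2) + ε / (|C| + 2) := by field_simp; ring
    linarith

end ApproximateUnit

/-! ### The kernel of `G × Ĝ` and transposes of translations -/

section PhaseSpace

variable {G : Type*} [CommGroup G] [TopologicalSpace G]

theorem PhaseSpace.char_mul (w : PhaseSpace G) (x y : G) : w.char (x * y) = w.char x * w.char y := by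
  simp [PhaseSpace.char]

theorem PhaseSpace.one_char (x : G) : (1 : PhaseSpace G).char x = 1 := Circle.coe_one

theorem PhaseSpace.mul_char (w z : PhaseSpace G) (x : G) : (w * z).char x = w.char x * z.char x :=
  Circle.coe_mul _ _

variable [IsTopologicalGroup G] [LocallyCompactSpace G]

variable (G) in
/-- The kernel `(u, z) ↦ χ(x)`, for `u = (x, _)` and `z = (_, χ)`, of the twisted translations. -/
def phaseKernel : UnimodularKernel (PhaseSpace G) where
  toFun u z := z.char u.1
  continuous_uncurry := by
    have h1 : Continuous fun x : PhaseSpace G × PhaseSpace G => x.2.2 :=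
      (continuous_snd (X := G) (Y := PontryaginDual G)).comp continuous_snd
    have h2 : Continuous fun x : PhaseSpace G × PhaseSpace G => x.1.1 :=
      (continuous_fst (X := G) (Y := PontryaginDual G)).comp continuous_fst
    exact continuous_induced_dom.comp
      ((continuous_eval (F := G →ₜ* Circle) (X := G) (Y := Circle)).comp (h1.prodMk h2))
  norm_apply u z := z.norm_char _

variable {A : Type*} [NonUnitalNormedCommRing A] [NormedSpace ℂ A] [IsScalarTower ℂ A A]
  [SMulCommClass ℂ A A]

variable (A) in
/-- The bilinear map `(a, φ) ↦ a ⊙ φ`. -/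
def arensL : A →L[ℂ] StrongDual ℂ A →L[ℂ] StrongDual ℂ A :=
  (ContinuousLinearMap.compL ℂ A A ℂ).flip.comp (ContinuousLinearMap.mul ℂ A).flip

variable {μ : Measure (PhaseSpace G)} [μ.IsHaarMeasure] {p q : ℝ≥0∞} [Fact (1 ≤ p)] [Fact (1 ≤ q)]

omit [LocallyCompactSpace G] in
theorem oplus_congr_ae {f f' : PhaseSpace G → A} {h h' : PhaseSpace G → StrongDual ℂ A}
    (hf : f =ᵐ[μ] f') (hh : h =ᵐ[μ] h') : oplus μ f h = oplus μ f' h' := by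
  ext1 z
  refine integral_congr_ae ?_
  filter_upwards [(measurePreserving_div_right μ z).quasiMeasurePreserving.ae_eq_comp hf, hh]
    with w h1 h2
  simp only [comp_apply] at h1
  simp only [leftTwistedTranslate, h1, h2]

/-- The operation `h ↦ (w ↦ χ(x_w) (a ⊙ h (w z)))` that is dual to `f ↦ a T^t_z f`. -/
def dualTranslate (a : A) (z : PhaseSpace G) (h : PhaseSpace G → StrongDual ℂ A)
    (w : PhaseSpace G) : StrongDual ℂ A :=
  z.char w.1 • arens a (h (w * z))

omit [Fact (1 ≤ q)] in
theorem memLp_dualTranslate (a : A) (z : PhaseSpace G) {h : PhaseSpace G → StrongDual ℂ A}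
    (hh : MemLp h q μ) : MemLp (dualTranslate a z h) q μ := by
  have hc : Continuous fun w : PhaseSpace G => z.char w.1 :=
    (phaseKernel G).continuous_comp continuous_id continuous_const
  have h1 := (arensL A a).comp_memLp'
    (hh.comp_measurePreserving (measurePreserving_mul_right μ z))
  refine h1.of_le (hc.aestronglyMeasurable.smul h1.1) (Eventually.of_forall fun w => ?_)
  rw [dualTranslate, norm_smul, PhaseSpace.norm_char, one_mul]
  exact le_rfl

-- Translate the integration variable by `z` and split the character of `z` at `w` into its values
-- at `u` and `w / u`. With `toDual_lmulLp_twistedTranslateLp`, this shows that `⊕` and the pairing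
-- give `Λ_a T^t_z` the same transpose.
omit [LocallyCompactSpace G] in
theorem oplus_mul_twistedTranslate (a : A) (z : PhaseSpace G) (f : PhaseSpace G → A)
    (h : PhaseSpace G → StrongDual ℂ A) :
    oplus μ (fun w => a * twistedTranslate z f w) h = oplus μ f (dualTranslate a z h) := by
  ext1 u
  rw [oplus, ← integral_mul_right_eq_self _ z, oplus]
  refine integral_congr_ae (Eventually.of_forall fun w => ?_)
  ext b
  have h1 : w * z / u = w / u * z := by rw [div_mul_eq_mul_div]
  have h2 : z.char w.1 = z.char u.1 * z.char (w / u).1 := by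
    rw [← PhaseSpace.char_mul]
    exact congrArg z.char (mul_div_cancel u.1 w.1).symm
  have h3 : (w / u * z).1 / z.1 = (w / u).1 := mul_div_cancel_right (w / u).1 z.1
  simp only [dualTranslate, leftTwistedTranslate, twistedTranslate, arens_apply, h1, h2, h3,
    PhaseSpace.mul_char, mul_div_cancel_right, mul_smul_comm, smul_mul_assoc, map_smul, smul_smul,
    smul_apply, smul_eq_mul, mul_assoc, mul_comm a]

omit [LocallyCompactSpace G] in
theorem lmulLp_twistedTranslateLp_ae_eq (a : A) (z : PhaseSpace G) (f : Lp A p μ) :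
    lmulLp a (twistedTranslateLp z f) =ᵐ[μ] fun w => a * twistedTranslate z f w := by
  filter_upwards [coeFn_lmulLp a (twistedTranslateLp z f),
    MemLp.coeFn_toLp (memLp_twistedTranslate z (Lp.memLp f))] with w h1 h2
  rw [h1]
  exact congrArg (a * ·) h2

variable [HolderConjugate p q]

theorem toDual_lmulLp_twistedTranslateLp (a : A) (z : PhaseSpace G) (f : Lp A p μ)
    (h : Lp (StrongDual ℂ A) q μ) :
    toDual (lmulLp a (twistedTranslateLp z f)) h =
      toDual f ((memLp_dualTranslate a z (Lp.memLp h)).toLp _) := by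
  rw [toDual_apply, toDual_apply, ← integral_mul_right_eq_self _ z]
  refine integral_congr_ae ?_
  filter_upwards [(measurePreserving_mul_right μ z).quasiMeasurePreserving.ae_eq_comp
    (lmulLp_twistedTranslateLp_ae_eq a z f),
    MemLp.coeFn_toLp (memLp_dualTranslate a z (Lp.memLp h))] with w h1 h2
  simp only [comp_apply] at h1
  have h3 : (w * z).1 / z.1 = w.1 := mul_div_cancel_right w.1 z.1
  rw [h1, h2]
  simp [dualTranslate, twistedTranslate, arens_apply, h3, mul_comm a, smul_mul_assoc]

-- Testing against `φ` times the indicator of a set of finite measure recovers `φ` of the integral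
-- over that set, and such integrals determine an element of `L^p`.
omit [IsTopologicalGroup G] [LocallyCompactSpace G] [IsScalarTower ℂ A A] [SMulCommClass ℂ A A]
  [μ.IsHaarMeasure] in
theorem toDual_injective [CompleteSpace A] (hp : p ≠ ∞) :
    Injective (toDual : Lp A p μ → StrongDual ℂ (Lp (StrongDual ℂ A) q μ)) := by
  intro f g hfg
  have hint (h : Lp A p μ) (s : Set (PhaseSpace G)) (hs : MeasurableSet s) (hμs : μ s < ∞) :
      IntegrableOn h s μ :=
    integrableOn_Lp_of_measure_ne_top h Fact.out hμs.ne
  refine Lp.ext (Lp.ae_eq_of_forall_setIntegral_eq _ _ (zero_lt_one.trans_le Fact.out).ne' hp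
    (hint _) (hint _) fun s hs hμs => ?_)
  refine (SeparatingDual.eq_iff_forall_dual_eq (R := ℂ)).2 fun φ => ?_
  have key (k : Lp A p μ) :
      φ (∫ w in s, k w ∂μ) = toDual k (indicatorConstLp q hs hμs.ne φ) := by
    rw [← φ.integral_comp_comm (hint k s hs hμs), toDual_apply, ← integral_indicator hs]
    refine integral_congr_ae ?_
    filter_upwards [indicatorConstLp_coeFn (p := q) (hs := hs) (hμs := hμs.ne) (c := φ)] with w hw
    rw [hw]
    by_cases h : w ∈ s <;> simp [h]
  rw [key, key, hfg]

end PhaseSpace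

/-! ### Duality between `· × f` and `f ⊕ ·` -/

section Adjoint

variable {G : Type*} [CommGroup G] [TopologicalSpace G] [IsTopologicalGroup G]
  [LocallyCompactSpace G] [T2Space G] {A : Type*} [NonUnitalNormedCommRing A] [NormedSpace ℂ A]
  [IsScalarTower ℂ A A] [SMulCommClass ℂ A A] [CompleteSpace A]
  {μ : Measure (PhaseSpace G)} [μ.IsHaarMeasure] [μ.Regular]
  {p q : ℝ≥0∞} [Fact (1 ≤ p)] [Fact (1 ≤ q)]

/-- The operation `⊕` as a bilinear map `L^1 × L^q → L^q`. -/
def oplusLp (hq : q ≠ ∞) :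
    Lp A 1 μ →L[ℂ] Lp (StrongDual ℂ A) q μ →L[ℂ] Lp (StrongDual ℂ A) q μ :=
  (kernelConvLp hq (phaseKernel G).reflect (arensL A).flip).flip.comp
    (invLp μ 1 A).toContinuousLinearMap

theorem coeFn_oplusLp (hq : q ≠ ∞) (f : Lp A 1 μ) (h : Lp (StrongDual ℂ A) q μ) :
    oplusLp hq f h =ᵐ[μ] oplus μ f h := by
  refine (coeFn_kernelConvLp hq _ _ h (invLp μ 1 A f)).trans ?_
  rw [kernelConv_congr_ae (ae_eq_refl _) (coeFn_invLp f)]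
  exact Eventually.of_forall fun z => kernelConv_reflect _ (arensL A) f h z

variable [HolderConjugate p q]

/-- Both sides are iterated integrals of one function of `(w, u)`. The supports of `h'` and `F'`
already confine it to a compact set, so `f'` need only be continuous. -/
theorem toDual_kernelConvLp_of_hasCompactSupport (hp : p ≠ ∞) (hq : q ≠ ∞) {F : Lp A p μ}
    {f : Lp A 1 μ} {h : Lp (StrongDual ℂ A) q μ} {F' f' : PhaseSpace G → A}
    {h' : PhaseSpace G → StrongDual ℂ A} (hF : F =ᵐ[μ] F') (hFc : Continuous F')
    (hFs : HasCompactSupport F') (hf : f =ᵐ[μ] f') (hfc : Continuous f')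
    (hh : h =ᵐ[μ] h') (hhc : Continuous h')
    (hhs : HasCompactSupport h') :
    toDual (kernelConvLp hp (phaseKernel G) (ContinuousLinearMap.mul ℂ A) F f) h =
      toDual F (oplusLp hq f h) := by
  set c := phaseKernel G
  have hk : Continuous fun x : PhaseSpace G × PhaseSpace G =>
      c x.2 (x.1 / x.2) • f' (x.1 / x.2) :=
    (c.continuous_comp continuous_snd (by fun_prop)).smul (hfc.comp (by fun_prop))
  have hΦ : Continuous (uncurry fun w u => h' w (F' u * (c u (w / u) • f' (w / u)))) :=
    (hhc.comp continuous_fst).clm_apply ((hFc.comp continuous_snd).mul hk)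
  have hΦs : HasCompactSupport (uncurry fun w u => h' w (F' u * (c u (w / u) • f' (w / u)))) := by
    refine HasCompactSupport.intro (hhs.isCompact.prod hFs.isCompact) ?_
    rintro ⟨w, u⟩ hwu
    rw [Set.mem_prod, not_and_or] at hwu
    rcases hwu with hw | hu
    · simp [image_eq_zero_of_notMem_tsupport hw]
    · simp [image_eq_zero_of_notMem_tsupport hu]
  have hleft : toDual (kernelConvLp hp c (ContinuousLinearMap.mul ℂ A) F f) h =
      ∫ w, ∫ u, h' w (F' u * (c u (w / u) • f' (w / u))) ∂μ ∂μ := by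
    rw [toDual_apply]
    refine integral_congr_ae ?_
    filter_upwards [coeFn_kernelConvLp hp c (ContinuousLinearMap.mul ℂ A) F f, hh] with w h1 h2
    rw [h1, h2, kernelConv_congr_ae hF hf, kernelConv_swap, kernelConv,
      ← (h' w).integral_comp_comm]
    · rfl
    · refine Continuous.integrable_of_hasCompactSupport ?_ ?_
      · exact (hFc.mul (hk.comp (Continuous.prodMk_right w)))
      · exact hFs.mul_right
  have hright : toDual F (oplusLp hq f h) =
      ∫ u, ∫ w, h' w (F' u * (c u (w / u) • f' (w / u))) ∂μ ∂μ := by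
    rw [toDual_apply]
    refine integral_congr_ae ?_
    filter_upwards [coeFn_oplusLp hq f h, hF] with u h1 h2
    rw [h1, h2, oplus_congr_ae hf hh, oplus, ContinuousLinearMap.integral_apply]
    · rfl
    · refine Continuous.integrable_of_hasCompactSupport ?_ ?_
      · exact (arensL A).continuous₂.comp ((hk.comp (Continuous.prodMk_left u)).prodMk hhc)
      · refine HasCompactSupport.intro hhs.isCompact fun w hw => ?_
        rw [image_eq_zero_of_notMem_tsupport hw]
        exact map_zero (arensL A _)
  rw [hleft, hright, integral_integral_swap_of_hasCompactSupport hΦ hΦs]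

omit [IsTopologicalGroup G] [LocallyCompactSpace G] [T2Space G] [IsScalarTower ℂ A A]
  [SMulCommClass ℂ A A] [CompleteSpace A] [μ.IsHaarMeasure] [μ.Regular] in
theorem continuous_toDual :
    Continuous fun x : Lp A p μ × Lp (StrongDual ℂ A) q μ => toDual x.1 x.2 :=
  ((NormedSpace.inclusionInDoubleDual ℂ A).lpPairing μ p q).continuous₂

theorem continuous_toDual_kernelConvLp (hp : p ≠ ∞) :
    Continuous fun x : Lp A p μ × Lp A 1 μ × Lp (StrongDual ℂ A) q μ =>
      toDual (kernelConvLp hp (phaseKernel G) (ContinuousLinearMap.mul ℂ A) x.1 x.2.1) x.2.2 := by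
  have hC := (kernelConvLp (p := p) (μ := μ) hp (phaseKernel G)
    (ContinuousLinearMap.mul ℂ A)).continuous₂
  have h1 : Continuous fun x : Lp A p μ × Lp A 1 μ × Lp (StrongDual ℂ A) q μ => (x.1, x.2.1) :=
    continuous_fst.prodMk (continuous_fst.comp continuous_snd)
  have h2 : Continuous fun x : Lp A p μ × Lp A 1 μ × Lp (StrongDual ℂ A) q μ => x.2.2 :=
    continuous_snd.comp continuous_snd
  have h3 := (hC.comp h1).prodMk h2
  have h4 := (continuous_toDual (p := p) (q := q) (μ := μ) (A := A)).comp h3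
  exact h4

theorem continuous_toDual_oplusLp (hq : q ≠ ∞) :
    Continuous fun x : Lp A p μ × Lp A 1 μ × Lp (StrongDual ℂ A) q μ =>
      toDual x.1 (oplusLp hq x.2.1 x.2.2) := by
  have hD := (oplusLp (μ := μ) (A := A) hq).continuous₂
  have h1 : Continuous fun x : Lp A p μ × Lp A 1 μ × Lp (StrongDual ℂ A) q μ => x.2 :=
    continuous_snd
  have h2 : Continuous fun x : Lp A p μ × Lp A 1 μ × Lp (StrongDual ℂ A) q μ => x.1 :=
    continuous_fst
  have h3 := h2.prodMk (hD.comp h1)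
  have h4 := (continuous_toDual (p := p) (q := q) (μ := μ) (A := A)).comp h3
  exact h4

/-- The operation `f ⊕ ·` is dual to the twisted convolution `· × f`. -/
theorem toDual_kernelConvLp (hp : p ≠ ∞) (hq : q ≠ ∞) (F : Lp A p μ) (f : Lp A 1 μ)
    (h : Lp (StrongDual ℂ A) q μ) :
    toDual (kernelConvLp hp (phaseKernel G) (ContinuousLinearMap.mul ℂ A) F f) h =
      toDual F (oplusLp hq f h) := by
  have hd := (dense_compactlySupportedLp (μ := μ) (E := A) hp).prod
    ((dense_compactlySupportedLp (μ := μ) (E := A) one_ne_top).prod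
      (dense_compactlySupportedLp (μ := μ) (E := StrongDual ℂ A) hq))
  refine congrFun (Continuous.ext_on hd (continuous_toDual_kernelConvLp hp)
    (continuous_toDual_oplusLp hq) ?_) (F, f, h)
  rintro ⟨F, f, h⟩ ⟨⟨F', hFc, hFs, hF⟩, ⟨f', hfc, -, hf⟩, ⟨h', hhc, hhs, hh⟩⟩
  exact toDual_kernelConvLp_of_hasCompactSupport hp hq hF hFc hFs hf hfc hh hhc hhs

end Adjoint

end

/-! ### Approximate identities for `×` and the weak-* limit `ν` -/

section

variable (X : Type*) [CommGroup X] [TopologicalSpace X]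

/-- The filter of small compact neighbourhoods of the identity. -/
def compactNhdsOne : Filter {K : Set X // IsCompact K ∧ K ∈ 𝓝 (1 : X)} :=
  comap Subtype.val (𝓝 (1 : X)).smallSets

instance [LocallyCompactSpace X] : (compactNhdsOne X).NeBot := by
  refine comap_neBot fun t ht => ?_
  obtain ⟨s, hs, hst⟩ := eventually_smallSets.1 ht
  obtain ⟨K, hK, hKs, hKc⟩ := local_compact_nhds hs
  exact ⟨⟨K, hKc, hK⟩, hst K hKs⟩

variable {X} in
theorem eventually_compactNhdsOne {P : X → Prop} (h : ∀ᶠ z in 𝓝 1, P z) :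
    ∀ᶠ K in compactNhdsOne X, ∀ z ∈ K.1, P z :=
  (eventually_smallSets_forall.2 h).comap _

variable {G : Type*} [CommGroup G] [TopologicalSpace G] [IsTopologicalGroup G]
  [LocallyCompactSpace G] [T2Space G]
  {A : Type*} [NonUnitalNormedCommRing A] [NormedSpace ℂ A]
  [IsScalarTower ℂ A A] [SMulCommClass ℂ A A] [CompleteSpace A]
  {μ : Measure (PhaseSpace G)} [μ.IsHaarMeasure] [μ.Regular]
  {p q : ℝ≥0∞} [Fact (1 ≤ p)] [Fact (1 ≤ q)]

omit [T2Space G] [IsScalarTower ℂ A A] [SMulCommClass ℂ A A] [CompleteSpace A] [μ.Regular] in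
theorem kernelTranslateLp_swap_one (f : Lp A p μ) :
    kernelTranslateLp (phaseKernel G).swap 1 f = f := by
  refine Lp.ext ((coeFn_kernelTranslateLp _ _ f).trans (Eventually.of_forall fun w => ?_))
  have h : (phaseKernel G).swap w 1 = 1 :=
    (congrArg (fun x : Circle => (x : ℂ)) (map_one (w.2 : G →ₜ* Circle))).trans Circle.coe_one
  simp [kernelTranslate, h]

/-- The functions `averageLp μ K a`, for small `K` and `a` in the bounded approximate identity of
`A`, form an approximate identity for the twisted convolution. -/
theorem tendsto_kernelConvLp_averageLp {l : Filter A} {C : ℝ} (hl : l.IsApproximateUnit)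
    (hC : ∀ᶠ e in l, ‖e‖ ≤ C) (f : Lp A 1 μ) :
    Tendsto (fun i : {K : Set (PhaseSpace G) // IsCompact K ∧ K ∈ 𝓝 1} × A =>
      kernelConvLp one_ne_top (phaseKernel G) (ContinuousLinearMap.mul ℂ A)
        (averageLp μ i.1.2.1 i.2) f) (compactNhdsOne (PhaseSpace G) ×ˢ l) (𝓝 f) := by
  set B := (ContinuousLinearMap.mul ℂ A).flip
  have h1 : Tendsto (fun i : {K : Set (PhaseSpace G) // IsCompact K ∧ K ∈ 𝓝 1} × A =>
      lmulLp i.2 f) (compactNhdsOne (PhaseSpace G) ×ˢ l) (𝓝 f) :=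
    (tendsto_lmulLp one_ne_top hl hC f).comp tendsto_snd
  rw [← tendsto_sub_nhds_zero_iff] at h1 ⊢
  have h2 : Tendsto (fun i : {K : Set (PhaseSpace G) // IsCompact K ∧ K ∈ 𝓝 1} × A =>
      kernelConvLp one_ne_top (phaseKernel G) (ContinuousLinearMap.mul ℂ A)
        (averageLp μ i.1.2.1 i.2) f - lmulLp i.2 f) (compactNhdsOne (PhaseSpace G) ×ˢ l)
      (𝓝 0) := by
    refine Metric.tendsto_nhds.2 fun ε hε => ?_
    set M : ℝ := ‖B‖ * |C| + 1
    have hM : 0 < M := by positivity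
    have hδ : 0 < ε / M := by positivity
    have h3 := eventually_compactNhdsOne
      (eventually_norm_kernelTranslateLp_sub_le one_ne_top (phaseKernel G).swap f 1 hδ)
    filter_upwards [h3.prod_mk hC] with i ⟨hi, hiC⟩
    have h4 := norm_kernelConvLp_averageLp_sub_le one_ne_top (phaseKernel G).swap B f i.1.2.1
      (Measure.measure_pos_of_mem_nhds μ i.1.2.2).ne' i.2 hi
    -- The average is the first factor here, so the estimate is made for the swapped kernel, whose
    -- translation by `1` is the identity.
    rw [kernelTranslateLp_swap_one, ← kernelConvLp_swap] at h4
    rw [dist_zero_right]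
    refine lt_of_le_of_lt h4 ?_
    calc ‖B‖ * (ε / M) * ‖i.2‖ ≤ ‖B‖ * (ε / M) * |C| := by
          gcongr
          exact hiC.trans (le_abs_self C)
      _ = (M - 1) * (ε / M) := by ring
      _ < M * (ε / M) := by gcongr; linarith
      _ = ε := mul_div_cancel₀ _ hM.ne'
  simpa using h2.add h1

variable [HolderConjugate p q]

/-- A bounded family of functionals converges pointwise along every ultrafilter. -/
theorem exists_tendsto_ultrafilter {W I : Type*} [NormedAddCommGroup W] [NormedSpace ℂ W]
    (U : Ultrafilter I) (Ψ : I → StrongDual ℂ W) {R : ℝ} (hR : 0 ≤ R)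
    (hΨ : ∀ᶠ i in U, ∀ w, ‖Ψ i w‖ ≤ R * ‖w‖) :
    ∃ ν : StrongDual ℂ W, ∀ w, Tendsto (fun i => Ψ i w) U (𝓝 (ν w)) := by
  have hball : ∀ᶠ i in U, StrongDual.toWeakDual (Ψ i) ∈
      WeakDual.toStrongDual ⁻¹' Metric.closedBall (0 : StrongDual ℂ W) R := by
    filter_upwards [hΨ] with i hi
    rw [Set.mem_preimage, mem_closedBall_zero_iff]
    exact ContinuousLinearMap.opNorm_le_bound _ hR hi
  obtain ⟨ν, -, hν⟩ := (WeakDual.isCompact_closedBall (𝕜 := ℂ) (0 : StrongDual ℂ W)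
    R).ultrafilter_le_nhds (U.map fun i => StrongDual.toWeakDual (Ψ i)) (le_principal_iff.2 hball)
  exact ⟨WeakDual.toStrongDual ν, fun w => ((WeakDual.eval_continuous w).tendsto ν).comp hν⟩

theorem exists_norm_bilin_le {V W : Type*} [NormedAddCommGroup V] [NormedSpace ℂ V]
    [NormedAddCommGroup W] [NormedSpace ℂ W] (D : V →L[ℂ] W →L[ℂ] ℂ) :
    ∃ M, 0 ≤ M ∧ ∀ v w, ‖D v w‖ ≤ M * ‖v‖ * ‖w‖ :=
  ⟨_, norm_nonneg D, D.le_opNorm₂⟩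

omit [IsTopologicalGroup G] [LocallyCompactSpace G] [T2Space G] [IsScalarTower ℂ A A]
  [SMulCommClass ℂ A A] [CompleteSpace A] [μ.IsHaarMeasure] [μ.Regular] in
variable (A μ p q) in
theorem exists_norm_toDual_apply_le :
    ∃ M, 0 ≤ M ∧ ∀ (g : Lp A p μ) (h : Lp (StrongDual ℂ A) q μ),
      ‖toDual g h‖ ≤ M * ‖g‖ * ‖h‖ := by
  have h := exists_norm_bilin_le ((NormedSpace.inclusionInDoubleDual ℂ A).lpPairing μ p q)
  exact h

omit [IsTopologicalGroup G] [LocallyCompactSpace G] [T2Space G] [IsScalarTower ℂ A A]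
  [SMulCommClass ℂ A A] [CompleteSpace A] [μ.IsHaarMeasure] [μ.Regular] in
theorem continuous_toDual_apply (h : Lp (StrongDual ℂ A) q μ) :
    Continuous fun g : Lp A p μ => toDual g h := by
  have h1 : Continuous fun g : Lp A p μ => (g, h) := Continuous.prodMk_left h
  have h2 := (continuous_toDual (p := p) (q := q) (μ := μ) (A := A)).comp h1
  exact h2

/-- An operator `T` with `T (e × f) = T e × f` is of the form `f ↦ ν ⋇ f`. -/
theorem exists_isDivideontimes (hA : HasBoundedApproximateIdentity A) (hp : p ≠ ∞) (hq : q ≠ ∞)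
    {T : Lp A 1 μ →L[ℂ] Lp A p μ}
    (hT : ∀ f g, T (kernelConvLp one_ne_top (phaseKernel G) (ContinuousLinearMap.mul ℂ A) f g) =
      kernelConvLp hp (phaseKernel G) (ContinuousLinearMap.mul ℂ A) (T f) g) :
    ∃ ν : StrongDual ℂ (Lp (StrongDual ℂ A) q μ),
      ∀ f : Lp A 1 μ, IsDivideontimes ν f (toDual (T f)) := by
  obtain ⟨l, C, hl, hC⟩ := hA
  have := hl.neBot
  let I := {K : Set (PhaseSpace G) // IsCompact K ∧ K ∈ 𝓝 1} × A
  let L : Filter I := compactNhdsOne (PhaseSpace G) ×ˢ l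
  obtain ⟨M, hM, hD⟩ := exists_norm_toDual_apply_le A μ p q
  -- Along an ultrafilter, weak-* compactness of balls gives a limit without passing to subnets.
  let U : Ultrafilter I := Ultrafilter.of L
  have hU : (U : Filter I) ≤ L := Ultrafilter.of_le L
  have hbound : ∀ᶠ i : I in U, ∀ h : Lp (StrongDual ℂ A) q μ,
      ‖toDual (T (averageLp μ i.1.2.1 i.2)) h‖ ≤ M * (‖T‖ * |C|) * ‖h‖ := by
    filter_upwards [hU (tendsto_snd.eventually hC)] with i hi h
    refine (hD _ h).trans ?_
    gcongr
    refine (T.le_opNorm _).trans ?_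
    gcongr
    exact (norm_averageLp_le _ _).trans (le_trans hi (le_abs_self C))
  obtain ⟨ν, hν⟩ := exists_tendsto_ultrafilter U
    (fun i : I => toDual (q := q) (T (averageLp μ i.1.2.1 i.2))) (by positivity) hbound
  refine ⟨ν, fun f h => ⟨oplusLp hq f h, coeFn_oplusLp hq f h, ?_⟩⟩
  have h2 : Tendsto (fun i : I => toDual (q := q) (T (kernelConvLp one_ne_top (phaseKernel G)
      (ContinuousLinearMap.mul ℂ A) (averageLp μ i.1.2.1 i.2) f)) h) U (𝓝 (toDual (T f) h)) := by
    have h3 := (continuous_toDual_apply (p := p) h).comp T.continuous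
    exact (h3.tendsto f).comp ((tendsto_kernelConvLp_averageLp hl hC f).mono_left hU)
  refine tendsto_nhds_unique h2 ((hν (oplusLp hq f h)).congr fun i => ?_)
  rw [hT, toDual_kernelConvLp hp hq]

-- After pairing with `h`, the operator `Λ_a T^t_z` is moved to `h` on both sides: inside `ν`
-- through `⊕`, and outside through the pairing.
omit [T2Space G] [μ.Regular] in
theorem map_lmulLp_twistedTranslateLp_of_isDivideontimes (hp : p ≠ ∞)
    {T : Lp A 1 μ →L[ℂ] Lp A p μ} {ν : StrongDual ℂ (Lp (StrongDual ℂ A) q μ)}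
    (hν : ∀ f : Lp A 1 μ, IsDivideontimes ν f (toDual (T f))) (a : A) (z : PhaseSpace G)
    (f : Lp A 1 μ) :
    T (lmulLp a (twistedTranslateLp z f)) = lmulLp a (twistedTranslateLp z (T f)) := by
  refine toDual_injective (q := q) hp (ContinuousLinearMap.ext fun h => ?_)
  obtain ⟨k, hk, hk'⟩ := hν (lmulLp a (twistedTranslateLp z f)) h
  obtain ⟨m, hm, hm'⟩ := hν f ((memLp_dualTranslate a z (Lp.memLp h)).toLp _)
  rw [hk', toDual_lmulLp_twistedTranslateLp, hm']
  refine congrArg ν (Lp.ext (hk.trans (EventuallyEq.trans (Eventually.of_forall ?_) hm.symm)))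
  refine congrFun ?_
  rw [oplus_congr_ae (lmulLp_twistedTranslateLp_ae_eq a z f) (ae_eq_refl h),
    oplus_mul_twistedTranslate,
    oplus_congr_ae (ae_eq_refl f) (MemLp.coeFn_toLp (memLp_dualTranslate a z (Lp.memLp h)))]

omit [IsTopologicalGroup G] [LocallyCompactSpace G] [T2Space G] [CompleteSpace A]
  [μ.IsHaarMeasure] [μ.Regular] in
theorem applyLp_mul (f : Lp A p μ) (a : A) :
    applyLp μ p (ContinuousLinearMap.mul ℂ A) f a = lmulLp a f :=
  (congrArg (· f) (lmulLp_eq_rmulLp a)).symm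

end

end WeylMultiplier

end

/-! ### The equivalence -/

open WeylMultiplier in
theorem mainTheorem2
    {G : Type*} [CommGroup G] [TopologicalSpace G] [IsTopologicalGroup G]
    [LocallyCompactSpace G] [T2Space G]
    (μ : Measure (PhaseSpace G)) [μ.IsHaarMeasure] [μ.Regular]
    {A : Type*} [NonUnitalNormedCommRing A] [NormedSpace ℂ A] [IsScalarTower ℂ A A]
    [SMulCommClass ℂ A A] [CompleteSpace A] (hA : HasBoundedApproximateIdentity A)
    (p q : ℝ≥0∞) [Fact (1 ≤ p)] [Fact (1 ≤ q)] [HolderConjugate p q] (hp : 1 < p) (hp' : p < ∞)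
    (T : Lp A 1 μ →L[ℂ] Lp A p μ) :
    [ IsWeylMultiplier T,
      ∀ (a : A) (z : PhaseSpace G) (f : Lp A 1 μ),
        T (lmulLp a (twistedTranslateLp z f)) = lmulLp a (twistedTranslateLp z (T f)),
      ∀ f g : Lp A 1 μ, ∃ k : Lp A 1 μ,
        k =ᵐ[μ] twistedConv μ f g ∧ T k =ᵐ[μ] twistedConv μ (T f) g,
      ∃ ν : StrongDual ℂ (Lp (StrongDual ℂ A) q μ),
        ∀ f : Lp A 1 μ, IsDivideontimes ν f (toDual (T f)) ].TFAE := by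
  -- This is where `1 < p` enters: density and strong continuity in `L^q` require `q < ∞`.
  have hq : q ≠ ∞ := ((HolderConjugate.lt_top_iff_one_lt q p).2 hp).ne
  have hconv {r : ℝ≥0∞} [Fact (1 ≤ r)] (hr : r ≠ ∞) (f : Lp A r μ) (g : Lp A 1 μ) :
      kernelConvLp hr (phaseKernel G) (ContinuousLinearMap.mul ℂ A) f g =ᵐ[μ] twistedConv μ f g :=
    coeFn_kernelConvLp hr _ _ f g
  have h3 (h : ∀ f g : Lp A 1 μ, ∃ k : Lp A 1 μ,
      k =ᵐ[μ] twistedConv μ f g ∧ T k =ᵐ[μ] twistedConv μ (T f) g) (f g : Lp A 1 μ) :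
      T (kernelConvLp one_ne_top (phaseKernel G) (ContinuousLinearMap.mul ℂ A) f g) =
        kernelConvLp hp'.ne (phaseKernel G) (ContinuousLinearMap.mul ℂ A) (T f) g := by
    obtain ⟨k, hk, hTk⟩ := h f g
    rw [← Lp.ext (hk.trans (hconv one_ne_top f g).symm)]
    exact Lp.ext (hTk.trans (hconv hp'.ne (T f) g).symm)
  tfae_have 1 → 3 := by
    rintro ⟨hT, hT'⟩ f g
    refine ⟨_, hconv one_ne_top f g, ?_⟩
    rw [map_kernelConvLp (r := p) one_ne_top hp'.ne (S := T)]
    · exact hconv hp'.ne (T f) g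
    · intro z f a
      exact (hT' a _).trans (congrArg (rmulLp a) (hT z f))
  tfae_have 3 → 2 := by
    intro h a z f
    have h1 := map_applyLp_kernelTranslateLp one_ne_top hp'.ne (S := T) (T := T) (h3 h f) z a
    rwa [applyLp_mul, applyLp_mul] at h1
  tfae_have 2 → 1 := by
    intro h
    obtain ⟨l, C, hl, hC⟩ := hA
    have := hl.neBot
    have hT (z : PhaseSpace G) (f : Lp A 1 μ) :
        T (twistedTranslateLp z f) = twistedTranslateLp z (T f) := by
      -- Let `e` run through the approximate identity in `T (e T^t_z f) = e T^t_z (T f)`.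
      have h1 := (T.continuous.tendsto _).comp
        (tendsto_lmulLp one_ne_top hl hC (twistedTranslateLp z f))
      have h2 := tendsto_lmulLp hp'.ne hl hC (twistedTranslateLp z (T f))
      exact tendsto_nhds_unique h1 (h2.congr fun e => (h e z f).symm)
    have h1 {r : ℝ≥0∞} [Fact (1 ≤ r)] (f : Lp A r μ) : twistedTranslateLp 1 f = f := by
      refine Lp.ext ((MemLp.coeFn_toLp (memLp_twistedTranslate 1 (Lp.memLp f))).trans
        (Filter.Eventually.of_forall fun w => ?_))
      rw [twistedTranslate, div_one, PhaseSpace.one_char, one_smul]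
    refine ⟨hT, fun a f => ?_⟩
    have h2 := h a 1 f
    rwa [h1, h1, lmulLp_eq_rmulLp, lmulLp_eq_rmulLp] at h2
  tfae_have 3 → 4 := fun h => exists_isDivideontimes hA hp'.ne hq (h3 h)
  tfae_have 4 → 2 := by
    rintro ⟨ν, hν⟩
    exact map_lmulLp_twistedTranslateLp_of_isDivideontimes hp'.ne hν
  tfae_finish
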